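/- Manifolds are Hausdorff, second countable, without boundary, and smooth means $C^\infty$. A foliation of a manifold $X$ is a completely integrable smooth subbundle $\mathcal F\subset T_X$ (of some constant rank), i.e. a subbundle which near every point is the tangent bundle to the level sets of the last components of a suitable chart; its leaves are the maximal connected integral submanifolds of $\mathcal F$, i.e. the classes of points which can be joined by finite chains of plaques. Let $M$ be a (non-empty) connected smooth manifold of dimension $m$ and let $\rho:G\times M\to M$ be an effective action of a group $G$ on $M$ such that, for every $g\in G$, the map $\rho_g:M\to M$, $\rho_g(x)=\rho(g,x)$, is a diffeomorphism. Suppose that the set of graphs $\{\mathrm{gr}(\rho_g)\mid g\in G\}$, where $\mathrm{gr}(\rho_g)=\{(x,\rho_g(x))\mid x\in M\}\subset M\times M$, coincides with the set of leaves of a foliation $\mathcal F$ of $M\times M$. Then: 1. the action $\rho$ is free and transitive; 2. there exists a unique Lie group structure of dimension $m$ on the group $G$ for which $\rho:G\times M\to M$ is smooth. (Unique: for any two such structures the identity map of $G$ is a diffeomorphism between them.) Suppose moreover that $M$ is a complex manifold of complex dimension $n$ (the maps $\rho_g$ still being diffeomorphisms of the underlying smooth manifold) and that the foliation $\mathcal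 F$ is holomorphic, i.e. $\mathcal F$ is a holomorphic subbundle of the tangent bundle $T_{M\times M}$. Then there exists a unique complex Lie group structure of complex dimension $n$ on $G$ for which the (free and transitive) action $\rho:G\times M\to M$ is holomorphic. -/

import Mathlib

open scoped Manifold ContDiff

section Foliations

variable {E H X : Type*} [NormedAddCommGroup E] [NormedSpace ℝ E] [TopologicalSpace H]
  [TopologicalSpace X] [ChartedSpace H X]

/-- A foliated (flat) chart for a field `D` of tangent subspaces on a smooth manifold `X`: a
diffeomorphism `φ` from an open subset of `X` onto an open subset of `ℝ^d × ℝ^q` such that `D` is,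
on the domain of `φ`, the tangent field of the level sets of the `ℝ^q`-component of `φ`. -/
structure IsFlatChart (I : ModelWithCorners ℝ E H) (D : ∀ x : X, Submodule ℝ (TangentSpace I x))
    {d q : ℕ} (φ : OpenPartialHomeomorph X
      (EuclideanSpace ℝ (Fin d) × EuclideanSpace ℝ (Fin q))) : Prop where
  contMDiffOn : ContMDiffOn I
    𝓘(ℝ, EuclideanSpace ℝ (Fin d) × EuclideanSpace ℝ (Fin q)) ∞ φ φ.source
  contMDiffOn_symm : ContMDiffOn
    𝓘(ℝ, EuclideanSpace ℝ (Fin d) × EuclideanSpace ℝ (Fin q)) I ∞ φ.symm φ.target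
  mem_iff : ∀ x ∈ φ.source, ∀ v : TangentSpace I x,
    v ∈ D x ↔ mfderiv I 𝓘(ℝ, EuclideanSpace ℝ (Fin q)) (fun z => (φ z).2) x v = 0

/-- A smooth foliation of `X`: a (completely) integrable subbundle of the tangent bundle of `X`,
of some rank `dim` and corank `codim`. -/
structure Foliation (I : ModelWithCorners ℝ E H) (X : Type*) [TopologicalSpace X]
    [ChartedSpace H X] where
  dim : ℕ
  codim : ℕ
  tangent : ∀ x : X, Submodule ℝ (TangentSpace I x)
  integrable : ∀ x : X, ∃ φ : OpenPartialHomeomorph X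
    (EuclideanSpace ℝ (Fin dim) × EuclideanSpace ℝ (Fin codim)),
      IsFlatChart I tangent φ ∧ x ∈ φ.source

namespace Foliation

variable {I : ModelWithCorners ℝ E H} (F : Foliation I X)

/-- `x` and `y` lie in a common plaque, i.e. in the same connected component of a level set of the
transverse component of some foliated chart. -/
def SamePlaque (x y : X) : Prop :=
  ∃ φ : OpenPartialHomeomorph X
      (EuclideanSpace ℝ (Fin F.dim) × EuclideanSpace ℝ (Fin F.codim)),
    IsFlatChart I F.tangent φ ∧ x ∈ φ.source ∧
      y ∈ connectedComponentIn {z | z ∈ φ.source ∧ (φ z).2 = (φ x).2} x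

/-- The leaf through `x`: all points that can be reached from `x` by a finite chain of plaques. -/
def leaf (x : X) : Set X := {y | Relation.ReflTransGen F.SamePlaque x y}

/-- The set of leaves of the foliation. -/
def leaves : Set (Set X) := Set.range F.leaf

end Foliation

end Foliations

/-- A foliation of (the smooth manifold underlying) a product `M × M` of a complex manifold `M`
with itself is holomorphic if its tangent field is a holomorphic subbundle of the tangent bundle:
locally it is the complex span of a pointwise `ℂ`-linearly independent family of holomorphic
vector fields. (The real and the complex tangent spaces at a point are literally the same
space `E × E`, in the same charts, and `C^∞` over `ℂ` means holomorphic.) -/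
def Foliation.IsHolomorphic {E M : Type*} [NormedAddCommGroup E] [NormedSpace ℂ E]
    [TopologicalSpace M] [ChartedSpace E M] [IsManifold 𝓘(ℂ, E) ∞ M]
    (F : Foliation (𝓘(ℝ, E).prod 𝓘(ℝ, E)) (M × M)) : Prop :=
  ∀ p : M × M, ∃ (k : ℕ) (V : Fin k → ∀ x : M × M, TangentSpace (𝓘(ℂ, E).prod 𝓘(ℂ, E)) x)
      (U : Set (M × M)), IsOpen U ∧ p ∈ U ∧
    (∀ i, ContMDiffOn (𝓘(ℂ, E).prod 𝓘(ℂ, E)) (𝓘(ℂ, E).prod 𝓘(ℂ, E)).tangent ∞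
      (fun x => (⟨x, V i x⟩ : TangentBundle (𝓘(ℂ, E).prod 𝓘(ℂ, E)) (M × M))) U) ∧
    ∀ x ∈ U, LinearIndependent ℂ (fun i => V i x) ∧
      ∀ v : E × E, v ∈ F.tangent x ↔ v ∈ Submodule.span ℂ (Set.range fun i => V i x)

/-- A Lie group structure over `𝕜` (real if `𝕜 = ℝ`, complex if `𝕜 = ℂ`), modelled on the vector
space `E`, on an abstract group `G`: a Hausdorff second countable topology and an atlas of
`E`-valued charts with `C^∞` (holomorphic if `𝕜 = ℂ`) transition maps, for which multiplication
and inversion are `C^∞` (holomorphic if `𝕜 = ℂ`). -/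
structure LieGroupStructure (𝕜 : Type*) [RCLike 𝕜] (E : Type*) [NormedAddCommGroup E]
    [NormedSpace 𝕜 E] (G : Type*) [Group G] where
  [topology : TopologicalSpace G]
  [charts : ChartedSpace E G]
  [t2 : T2Space G]
  [secondCountable : SecondCountableTopology G]
  [lieGroup : LieGroup 𝓘(𝕜, E) ∞ G]

namespace LieGroupStructure

variable {𝕜 : Type*} [RCLike 𝕜] {E : Type*} [NormedAddCommGroup E] [NormedSpace 𝕜 E]
  {G : Type*} [Group G]

/-- The action of `G` on the manifold `M` is smooth (holomorphic if `𝕜 = ℂ`) as a map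
`G × M → M`, for the given Lie group structure on `G`. -/
def ActsSmoothlyOn (S : LieGroupStructure 𝕜 E G) (M : Type*) [TopologicalSpace M]
    [ChartedSpace E M] [MulAction G M] : Prop :=
  letI := S.topology
  letI := S.charts
  ContMDiff (𝓘(𝕜, E).prod 𝓘(𝕜, E)) 𝓘(𝕜, E) ∞ (fun p : G × M => p.1 • p.2)

/-- The identity of `G` is a `C^∞` map from `(G, S)` to `(G, T)`. -/
def IdContMDiff (S T : LieGroupStructure 𝕜 E G) : Prop :=
  @ContMDiff 𝕜 _ E _ _ E _ 𝓘(𝕜, E) G S.topology S.charts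
    E _ _ E _ 𝓘(𝕜, E) G T.topology T.charts ∞ (id : G → G)

/-- Two (atlases of) Lie group structures on `G` define the same structure, i.e. the same topology
and the same maximal atlas: the identity map is a diffeomorphism (biholomorphic if `𝕜 = ℂ`). -/
def Same (S T : LieGroupStructure 𝕜 E G) : Prop := S.IdContMDiff T ∧ T.IdContMDiff S

end LieGroupStructure

/-!
Every point of `M × M` lies on exactly one graph, so the action is transitive; it is free because
two graphs which meet coincide and the action is effective. Hence there is a map `transport`, with
`transport G x y z = g • z` for the unique `g` such that `g • x = y`; the theorem amounts to its
smoothness. Indeed `G` is identified with `M` by the orbit map `g ↦ g • x₀`, and in terms of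
`transport` the action is `transport x₀ (g • x₀) z`, and the inverse of `g` corresponds to
`transport (g • x₀) x₀ x₀` (`exists_lieGroupStructure`).

*Smoothness near the diagonal* `x = z`. A leaf is covered by countably many level sets of flat
charts (`Foliation.exists_countable_cover_leaf`); since the diagonal of `M × M` is a leaf, counting
Hausdorff dimensions shows that leaves have dimension at least `dim M`
(`Foliation.finrank_le_dim`). Plaques lie in graphs of diffeomorphisms, so they are nowhere tangent
to the second factor (`eq_zero_of_fderiv_coordChart_eq_zero`). By the inverse function theorem the
plaques are locally the graphs `v = θ (u, c)`, where `c = ψ (u, v)` is the transverse component of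
a flat chart, and `transport` is `θ (z, ψ (x, y))` in coordinates (`exists_local_transport`).

*Smoothness everywhere.* The rule `transport z (transport x y z) w = transport x y w` and
the connectedness of `M` propagate smoothness in the last variable
(`contMDiff_transport_of_eventually`).

*Uniqueness.* For a Lie group structure on `G` acting smoothly, an orbit map is a smooth bijection
between manifolds of the same dimension, of constant rank by equivariance. The rank is maximal,
for otherwise the image would have measure zero; so the orbit map is a diffeomorphism
(`contMDiff_orbit_symm`), and two such structures are both diffeomorphic to `M`.

*The holomorphic case.* Here the tangent spaces of the leaves are graphs of complex linear maps
`L (u, v)` depending holomorphically on `(u, v)`. The functions `θ (·, c)` solve `∂θ/∂u = L (u, θ)`,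
and the antilinear part of the derivative of transport in the second variable solves the linearized
equation with initial value zero, so that it vanishes
(`eventually_contDiffAt_complex_transport`).
-/

open Set Filter Topology

/-! ### Flat charts and countable covers of leaves -/

section FlatCharts

variable {E H X : Type*} [NormedAddCommGroup E] [NormedSpace ℝ E] [TopologicalSpace H]
  [TopologicalSpace X] [ChartedSpace H X] {I : ModelWithCorners ℝ E H}
  {D : ∀ x : X, Submodule ℝ (TangentSpace I x)}

namespace IsFlatChart

variable {d q d' q' : ℕ}
  {φ : OpenPartialHomeomorph X (EuclideanSpace ℝ (Fin d) × EuclideanSpace ℝ (Fin q))}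
  {ψ : OpenPartialHomeomorph X (EuclideanSpace ℝ (Fin d') × EuclideanSpace ℝ (Fin q'))}

theorem mdifferentiableAt_snd (hφ : IsFlatChart I D φ) {x : X} (hx : x ∈ φ.source) :
    MDifferentiableAt I 𝓘(ℝ, EuclideanSpace ℝ (Fin q)) (fun z => (φ z).2) x := by
  have h1 : MDifferentiableAt I 𝓘(ℝ, EuclideanSpace ℝ (Fin d) × EuclideanSpace ℝ (Fin q)) φ x :=
    (hφ.contMDiffOn.contMDiffAt (φ.open_source.mem_nhds hx)).mdifferentiableAt (by simp)
  exact (differentiableAt_snd (𝕜 := ℝ)).mdifferentiableAt.comp x h1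

theorem mdifferentiableAt_symm_slice (hφ : IsFlatChart I D φ) {w : EuclideanSpace ℝ (Fin d)}
    {c : EuclideanSpace ℝ (Fin q)} (hw : (w, c) ∈ φ.target) :
    MDifferentiableAt 𝓘(ℝ, EuclideanSpace ℝ (Fin d)) I (fun w' => φ.symm (w', c)) w := by
  have h1 : MDifferentiableAt 𝓘(ℝ, EuclideanSpace ℝ (Fin d) × EuclideanSpace ℝ (Fin q)) I
      φ.symm (w, c) :=
    (hφ.contMDiffOn_symm.contMDiffAt (φ.open_target.mem_nhds hw)).mdifferentiableAt (by simp)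
  have h2 : DifferentiableAt ℝ (fun w' : EuclideanSpace ℝ (Fin d) => (w', c)) w :=
    differentiableAt_id.prodMk (differentiableAt_const c)
  exact h1.comp w h2.mdifferentiableAt

/-- The slices of a flat chart with constant transverse component are tangent to `D`. -/
theorem mfderiv_symm_slice_mem (hφ : IsFlatChart I D φ) {w : EuclideanSpace ℝ (Fin d)}
    {c : EuclideanSpace ℝ (Fin q)} (hw : (w, c) ∈ φ.target) (v : EuclideanSpace ℝ (Fin d)) :
    mfderiv 𝓘(ℝ, EuclideanSpace ℝ (Fin d)) I (fun w' => φ.symm (w', c)) w v ∈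
      D (φ.symm (w, c)) := by
  rw [hφ.mem_iff _ (φ.map_target hw)]
  have h := mfderiv_comp_apply w (hφ.mdifferentiableAt_snd (φ.map_target hw))
    (hφ.mdifferentiableAt_symm_slice hw) v
  have hev : ((fun z => (φ z).2) ∘ fun w' => φ.symm (w', c)) =ᶠ[𝓝 w] fun _ => c := by
    have hc : ContinuousAt (fun w' : EuclideanSpace ℝ (Fin d) => (w', c)) w := by fun_prop
    filter_upwards [hc (φ.open_target.mem_nhds hw)] with w' hw'
    simp [φ.right_inv hw']
  rw [hev.mfderiv_eq, mfderiv_const] at h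
  exact h.symm

/-- On a small neighbourhood, the level sets of the transverse component of one flat chart are
contained in those of another. -/
theorem eventually_snd_eq (hφ : IsFlatChart I D φ) (hψ : IsFlatChart I D ψ) {x : X}
    (hx : x ∈ φ.source) (hx' : x ∈ ψ.source) :
    ∀ᶠ y in 𝓝 x, (φ y).2 = (φ x).2 → (ψ y).2 = (ψ x).2 := by
  have hS : φ.target ∩ φ.symm ⁻¹' ψ.source ∈ 𝓝 (φ x) :=
    (φ.isOpen_inter_preimage_symm ψ.open_source).mem_nhds
      ⟨φ.map_source hx, by simpa [φ.left_inv hx] using hx'⟩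
  obtain ⟨r, hr, hball⟩ := Metric.mem_nhds_iff.1 hS
  set c := (φ x).2 with hc
  have hmem : ∀ w ∈ Metric.ball (φ x).1 r, (w, c) ∈ φ.target ∩ φ.symm ⁻¹' ψ.source := by
    intro w hw
    apply hball
    rw [← ball_prod_same]
    exact ⟨hw, Metric.mem_ball_self hr⟩
  have hder : ∀ w ∈ Metric.ball (φ x).1 r,
      HasFDerivAt (fun w' => (ψ (φ.symm (w', c))).2) (0 : _ →L[ℝ] _) w := by
    intro w hw
    obtain ⟨h1, h2⟩ := hmem w hw
    have hs := hφ.mdifferentiableAt_symm_slice h1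
    have hd := hψ.mdifferentiableAt_snd h2
    have hcomp := hd.comp w hs
    have : mfderiv 𝓘(ℝ, EuclideanSpace ℝ (Fin d)) 𝓘(ℝ, EuclideanSpace ℝ (Fin q'))
        ((fun z => (ψ z).2) ∘ fun w' => φ.symm (w', c)) w = 0 := by
      ext1 v
      rw [mfderiv_comp_apply w hd hs v]
      exact (hψ.mem_iff _ h2 _).1 (hφ.mfderiv_symm_slice_mem h1 v)
    rw [mfderiv_eq_fderiv] at this
    have h3 := (mdifferentiableAt_iff_differentiableAt.1 hcomp).hasFDerivAt
    rw [this] at h3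
    exact h3
  have hconst : ∀ w ∈ Metric.ball (φ x).1 r, (ψ (φ.symm (w, c))).2 = (ψ x).2 := by
    intro w hw
    have := (convex_ball (φ x).1 r).is_const_of_fderivWithin_eq_zero (𝕜 := ℝ)
      (f := fun w' => (ψ (φ.symm (w', c))).2)
      (fun w hw => (hder w hw).differentiableAt.differentiableWithinAt)
      (fun w hw => by
        rw [fderivWithin_of_isOpen Metric.isOpen_ball hw, (hder w hw).fderiv])
      hw (Metric.mem_ball_self hr)
    rw [this]
    have : ((φ x).1, c) = φ x := rfl
    simp [this, φ.left_inv hx]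
  have hcont : ContinuousAt (fun y => (φ y).1) x :=
    continuous_fst.continuousAt.comp (φ.continuousAt hx)
  filter_upwards [hcont (Metric.ball_mem_nhds _ hr), φ.open_source.mem_nhds hx] with y hy hys hyc
  have := hconst _ hy
  rwa [← hyc, Prod.mk.eta, φ.left_inv hys] at this

end IsFlatChart

namespace Foliation

variable (F : Foliation I X)

theorem SamePlaque.symm {F : Foliation I X} {x y : X} (h : F.SamePlaque x y) :
    F.SamePlaque y x := by
  obtain ⟨φ, hφ, hx, hy⟩ := h
  have hy' := connectedComponentIn_subset _ _ hy
  refine ⟨φ, hφ, hy'.1, ?_⟩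
  rw [hy'.2, ← connectedComponentIn_eq hy]
  exact mem_connectedComponentIn ⟨hx, rfl⟩

theorem SamePlaque.of_isPreconnected {F : Foliation I X}
    {φ : OpenPartialHomeomorph X
      (EuclideanSpace ℝ (Fin F.dim) × EuclideanSpace ℝ (Fin F.codim))}
    (hφ : IsFlatChart I F.tangent φ) {s : Set X} (hs : IsPreconnected s) {x y : X} (hx : x ∈ s)
    (hy : y ∈ s) (hsub : ∀ z ∈ s, z ∈ φ.source ∧ (φ z).2 = (φ x).2) : F.SamePlaque x y :=
  ⟨φ, hφ, (hsub x hx).1, hs.subset_connectedComponentIn hx hsub hy⟩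

theorem self_mem_leaf (x : X) : x ∈ F.leaf x := Relation.ReflTransGen.refl

theorem leaf_eq_of_mem {x y : X} (h : y ∈ F.leaf x) : F.leaf y = F.leaf x := by
  have : Std.Symm F.SamePlaque := ⟨fun _ _ h => h.symm⟩
  have hs : x ∈ F.leaf y := Std.Symm.symm (r := Relation.ReflTransGen F.SamePlaque) _ _ h
  ext z
  exact ⟨fun hz => Relation.ReflTransGen.trans h hz, fun hz => Relation.ReflTransGen.trans hs hz⟩

/-- A leaf of a foliation of a second countable space is covered by countably many level sets of
transverse components of flat charts. Countably many flat charts cover the space; as the transverse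
component of one of them is locally constant along a level set of another, each level set meets
only countably many others, so that finite chains reach only countably many level sets in all. -/
theorem exists_countable_cover_leaf [SecondCountableTopology X] (x₀ : X) :
    ∃ R : Set (OpenPartialHomeomorph X
        (EuclideanSpace ℝ (Fin F.dim) × EuclideanSpace ℝ (Fin F.codim)) ×
          EuclideanSpace ℝ (Fin F.codim)),
      R.Countable ∧ (∀ r ∈ R, IsFlatChart I F.tangent r.1) ∧
        ∀ y ∈ F.leaf x₀, ∃ r ∈ R, y ∈ r.1.source ∧ (r.1 y).2 = r.2 := by
  choose φ hφ hmem using F.integrable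
  obtain ⟨s, hs, hcover⟩ := TopologicalSpace.countable_cover_nhds
    (fun x => (φ x).open_source.mem_nhds (hmem x))
  -- a pair `(i, c)` stands for the level set `P (i, c)` of the chart `φ i`; `next R` consists of
  -- the level sets of the covering charts which meet a level set in `R`
  let P : X × EuclideanSpace ℝ (Fin F.codim) → Set X :=
    fun r => {y | y ∈ (φ r.1).source ∧ (φ r.1 y).2 = r.2}
  let next : Set (X × EuclideanSpace ℝ (Fin F.codim)) →
      Set (X × EuclideanSpace ℝ (Fin F.codim)) :=
    fun R => ⋃ r ∈ R, ⋃ j ∈ s, (fun y => (j, (φ j y).2)) '' (P r ∩ (φ j).source)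
  have hnext : ∀ R, R.Countable → (next R).Countable := by
    intro R hR
    refine hR.biUnion fun r _ => hs.biUnion fun j _ => ?_
    -- a locally constant function on a Lindelöf set takes countably many values
    have hloc : ∀ y ∈ P r ∩ (φ j).source, {z | (φ r.1 z).2 = (φ r.1 y).2 →
        (φ j z).2 = (φ j y).2} ∈ 𝓝[P r ∩ (φ j).source] y := fun y hy =>
      mem_nhdsWithin_of_mem_nhds ((hφ r.1).eventually_snd_eq (hφ j) hy.1.1 hy.2)
    obtain ⟨t, ht, htc, hsub⟩ := TopologicalSpace.countable_cover_nhdsWithin hloc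
    refine (htc.image fun y => (j, (φ j y).2)).mono ?_
    rintro _ ⟨y, hy, rfl⟩
    obtain ⟨z, hz, hyz⟩ := mem_iUnion₂.1 (hsub hy)
    exact ⟨z, hz, congrArg (Prod.mk j) (hyz (hy.1.2.trans (ht hz).1.2.symm)).symm⟩
  obtain ⟨i₀, hi₀, hx₀⟩ := mem_iUnion₂.1 (hcover.symm ▸ mem_univ x₀ : x₀ ∈ ⋃ x ∈ s, (φ x).source)
  let R : ℕ → Set (X × EuclideanSpace ℝ (Fin F.codim)) :=
    fun n => next^[n] {(i₀, (φ i₀ x₀).2)}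
  have hRsucc : ∀ n, R (n + 1) = next (R n) := fun n => Function.iterate_succ_apply' ..
  have hR : ∀ n, (R n).Countable := by
    intro n
    induction n with
    | zero => exact countable_singleton _
    | succ n ih => rw [hRsucc]; exact hnext _ ih
  let W : Set X := {y | ∃ n, ∃ r ∈ R n, y ∈ P r}
  have hstep : ∀ y z, F.SamePlaque y z → y ∈ W → z ∈ W := by
    rintro y z ⟨ψ, hψ, hy, hz⟩ hyW
    -- membership in `W` is locally constant along the plaque, which is connected
    have hyK := mem_connectedComponentIn (show y ∈ {z | z ∈ ψ.source ∧ (ψ z).2 = (ψ y).2} from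
      ⟨hy, rfl⟩)
    refine (isPreconnected_connectedComponentIn.induction₂ (fun a b => a ∈ W ↔ b ∈ W) ?_
      (fun _ _ _ _ _ _ => Iff.trans) (fun _ _ _ _ => Iff.symm) hyK hz).1 hyW
    intro a ha
    obtain ⟨ha1, ha2⟩ := connectedComponentIn_subset _ _ ha
    obtain ⟨j, hj, haj⟩ := mem_iUnion₂.1 (hcover.symm ▸ mem_univ a : a ∈ ⋃ x ∈ s, (φ x).source)
    filter_upwards [mem_nhdsWithin_of_mem_nhds (hψ.eventually_snd_eq (hφ j) ha1 haj),
      mem_nhdsWithin_of_mem_nhds ((φ j).open_source.mem_nhds haj), self_mem_nhdsWithin]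
      with b hb hbj hbK
    have hab : (φ j b).2 = (φ j a).2 :=
      hb ((connectedComponentIn_subset _ _ hbK).2.trans ha2.symm)
    have key : ∀ a b, a ∈ (φ j).source → b ∈ (φ j).source → (φ j b).2 = (φ j a).2 →
        a ∈ W → b ∈ W := by
      rintro a b ha hb hab ⟨n, r, hr, har⟩
      refine ⟨n + 1, (j, (φ j a).2), ?_, hb, hab⟩
      rw [hRsucc]
      exact mem_biUnion hr (mem_biUnion hj ⟨a, ⟨har, ha⟩, rfl⟩)
    exact ⟨key a b haj hbj hab, key b a hbj haj hab.symm⟩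
  refine ⟨(fun r => (φ r.1, r.2)) '' ⋃ n, R n, (countable_iUnion hR).image _, ?_, ?_⟩
  · rintro _ ⟨r, -, rfl⟩
    exact hφ r.1
  · intro y hy
    have hyW : y ∈ W := by
      induction hy with
      | refl => exact ⟨0, _, rfl, hx₀, rfl⟩
      | tail _ h ih => exact hstep _ _ h ih
    obtain ⟨n, r, hr, hyr⟩ := hyW
    exact ⟨_, ⟨r, mem_iUnion.2 ⟨n, hr⟩, rfl⟩, hyr⟩

end Foliation

end FlatCharts

/-! ### Plaques through a point -/

section Plaques

variable {E H X : Type*} [NormedAddCommGroup E] [NormedSpace ℝ E] [TopologicalSpace H]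
  [TopologicalSpace X] [ChartedSpace H X] {I : ModelWithCorners ℝ E H}

theorem Foliation.eventually_symm_mem_leaf (F : Foliation I X)
    {φ : OpenPartialHomeomorph X
      (EuclideanSpace ℝ (Fin F.dim) × EuclideanSpace ℝ (Fin F.codim))}
    (hφ : IsFlatChart I F.tangent φ) {x : X} (hx : x ∈ φ.source) :
    ∀ᶠ w in 𝓝 (φ x).1, φ.symm (w, (φ x).2) ∈ F.leaf x := by
  obtain ⟨r, hr, hball⟩ := Metric.mem_nhds_iff.1 (φ.open_target.mem_nhds (φ.map_source hx))
  have hmem : ∀ w ∈ Metric.ball (φ x).1 r, (w, (φ x).2) ∈ φ.target := fun w hw => by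
    apply hball
    rw [← ball_prod_same]
    exact ⟨hw, Metric.mem_ball_self hr⟩
  filter_upwards [Metric.ball_mem_nhds _ hr] with w hw
  refine Relation.ReflTransGen.single (Foliation.SamePlaque.of_isPreconnected hφ
    (s := (fun w => φ.symm (w, (φ x).2)) '' Metric.ball (φ x).1 r)
    ((convex_ball _ r).isPreconnected.image _ ?_)
    ⟨_, Metric.mem_ball_self hr, φ.left_inv hx⟩ ⟨w, hw, rfl⟩ ?_)
  · exact φ.continuousOn_symm.comp (by fun_prop) hmem
  · rintro _ ⟨w, hw, rfl⟩
    exact ⟨φ.map_target (hmem w hw), by rw [φ.right_inv (hmem w hw)]⟩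

end Plaques

/-! ### Product charts of `M × M` -/

section ProductCharts

variable {𝕜 : Type*} [NontriviallyNormedField 𝕜] {E M : Type*} [NormedAddCommGroup E]
  [NormedSpace 𝕜 E] [TopologicalSpace M] [ChartedSpace E M]

theorem contMDiffOn_prod_chart [IsManifold 𝓘(𝕜, E) ∞ M] (x y : M) :
    ContMDiffOn (𝓘(𝕜, E).prod 𝓘(𝕜, E)) 𝓘(𝕜, E × E) ∞ ((chartAt E x).prod (chartAt E y))
      ((chartAt E x).prod (chartAt E y)).source := by
  have h1 : ContMDiffOn (𝓘(𝕜, E).prod 𝓘(𝕜, E)) 𝓘(𝕜, E) ∞ (fun p : M × M => chartAt E x p.1)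
      ((chartAt E x).prod (chartAt E y)).source :=
    (contMDiffOn_chart (I := 𝓘(𝕜, E)) (x := x)).comp contMDiff_fst.contMDiffOn fun p hp => hp.1
  have h2 : ContMDiffOn (𝓘(𝕜, E).prod 𝓘(𝕜, E)) 𝓘(𝕜, E) ∞ (fun p : M × M => chartAt E y p.2)
      ((chartAt E x).prod (chartAt E y)).source :=
    (contMDiffOn_chart (I := 𝓘(𝕜, E)) (x := y)).comp contMDiff_snd.contMDiffOn fun p hp => hp.2
  exact h1.prodMk_space h2

theorem contMDiffOn_prod_chart_symm [IsManifold 𝓘(𝕜, E) ∞ M] (x y : M) :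
    ContMDiffOn 𝓘(𝕜, E × E) (𝓘(𝕜, E).prod 𝓘(𝕜, E)) ∞ ((chartAt E x).prod (chartAt E y)).symm
      ((chartAt E x).prod (chartAt E y)).target := by
  have h1 : ContMDiffOn 𝓘(𝕜, E × E) 𝓘(𝕜, E) ∞ (fun z : E × E => (chartAt E x).symm z.1)
      ((chartAt E x).prod (chartAt E y)).target :=
    (contMDiffOn_chart_symm (I := 𝓘(𝕜, E)) (x := x)).comp contDiff_fst.contMDiff.contMDiffOn
      fun p hp => hp.1
  have h2 : ContMDiffOn 𝓘(𝕜, E × E) 𝓘(𝕜, E) ∞ (fun z : E × E => (chartAt E y).symm z.2)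
      ((chartAt E x).prod (chartAt E y)).target :=
    (contMDiffOn_chart_symm (I := 𝓘(𝕜, E)) (x := y)).comp contDiff_snd.contMDiff.contMDiffOn
      fun p hp => hp.2
  exact h1.prodMk h2

end ProductCharts

section Coordinates

variable {E M : Type*} [NormedAddCommGroup E] [NormedSpace ℝ E] [TopologicalSpace M]
  [ChartedSpace E M]

/-- A chart of `M × M`, read in the product of the charts of `M` at `x` and `y`. -/
noncomputable def coordChart (E : Type*) {M : Type*} [NormedAddCommGroup E] [TopologicalSpace M]
    [ChartedSpace E M] {B : Type*} [TopologicalSpace B] (φ : OpenPartialHomeomorph (M × M) B)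
    (x y : M) : OpenPartialHomeomorph (E × E) B :=
  ((chartAt E x).prod (chartAt E y)).symm.trans φ

variable {D : ∀ x : M × M, Submodule ℝ (TangentSpace (𝓘(ℝ, E).prod 𝓘(ℝ, E)) x)} {d q : ℕ}
  {φ : OpenPartialHomeomorph (M × M) (EuclideanSpace ℝ (Fin d) × EuclideanSpace ℝ (Fin q))}

theorem IsFlatChart.contDiffOn_coordChart [IsManifold 𝓘(ℝ, E) ∞ M]
    (hφ : IsFlatChart (𝓘(ℝ, E).prod 𝓘(ℝ, E)) D φ) (x y : M) :
    ContDiffOn ℝ ∞ (coordChart E φ x y) (coordChart E φ x y).source := by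
  rw [← contMDiffOn_iff_contDiffOn]
  exact hφ.contMDiffOn.comp
    ((contMDiffOn_prod_chart_symm (𝕜 := ℝ) (E := E) x y).mono fun z hz => hz.1) fun z hz => hz.2

theorem IsFlatChart.contDiffOn_coordChart_symm [IsManifold 𝓘(ℝ, E) ∞ M]
    (hφ : IsFlatChart (𝓘(ℝ, E).prod 𝓘(ℝ, E)) D φ) (x y : M) :
    ContDiffOn ℝ ∞ (coordChart E φ x y).symm (coordChart E φ x y).target := by
  rw [← contMDiffOn_iff_contDiffOn]
  exact (contMDiffOn_prod_chart (𝕜 := ℝ) (E := E) x y).comp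
    (hφ.contMDiffOn_symm.mono fun z hz => hz.1) fun z hz => hz.2

/-- The kernel of the derivative of the transverse component, in coordinates. -/
theorem IsFlatChart.fderiv_coordChart_eq_zero_iff [IsManifold 𝓘(ℝ, E) ∞ M]
    (hφ : IsFlatChart (𝓘(ℝ, E).prod 𝓘(ℝ, E)) D φ) (x y : M) {z : E × E}
    (hz : z ∈ (coordChart E φ x y).source) (w : E × E) :
    fderiv ℝ (fun z => (coordChart E φ x y z).2) z w = 0 ↔
      mfderiv 𝓘(ℝ, E × E) (𝓘(ℝ, E).prod 𝓘(ℝ, E))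
        ((chartAt E x).prod (chartAt E y)).symm z w ∈
          D (((chartAt E x).prod (chartAt E y)).symm z) := by
  have h1 := hφ.mdifferentiableAt_snd hz.2
  have h2 := ((contMDiffOn_prod_chart_symm (𝕜 := ℝ) x y).contMDiffAt
    (((chartAt E x).prod (chartAt E y)).open_target.mem_nhds hz.1)).mdifferentiableAt (by simp)
  have h3 := mfderiv_comp_apply z h1 h2 w
  rw [mfderiv_eq_fderiv] at h3
  exact (Eq.congr_left h3).trans (hφ.mem_iff _ hz.2 (mfderiv 𝓘(ℝ, E × E)
    (𝓘(ℝ, E).prod 𝓘(ℝ, E)) ((chartAt E x).prod (chartAt E y)).symm z w)).symm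

end Coordinates

/-! ### The dimension of the leaves -/

section Dimension

variable {E M : Type*} [NormedAddCommGroup E] [NormedSpace ℝ E] [FiniteDimensional ℝ E]
  [TopologicalSpace M] [ChartedSpace E M] [IsManifold 𝓘(ℝ, E) ∞ M]

/-- If the diagonal of `M × M` lies in one leaf, then the leaves have dimension at least `dim M`:
the diagonal is a countable union of pieces of level sets of flat charts, which project to
subsets of `M` of Hausdorff dimension at most that of the leaves. -/
theorem Foliation.finrank_le_dim [SecondCountableTopology M]
    (F : Foliation (𝓘(ℝ, E).prod 𝓘(ℝ, E)) (M × M)) (x₀ : M)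
    (h : ∀ x, (x, x) ∈ F.leaf (x₀, x₀)) : Module.finrank ℝ E ≤ F.dim := by
  obtain ⟨R, hR, hflat, hcover⟩ := F.exists_countable_cover_leaf (x₀, x₀)
  let A := EuclideanSpace ℝ (Fin F.dim)
  let C := EuclideanSpace ℝ (Fin F.codim)
  let f : OpenPartialHomeomorph (M × M) (A × C) × C → A → E :=
    fun r w => chartAt E x₀ (r.1.symm (w, r.2)).1
  let Ω : OpenPartialHomeomorph (M × M) (A × C) × C → Set A :=
    fun r => {w | (w, r.2) ∈ r.1.target ∧ (r.1.symm (w, r.2)).1 ∈ (chartAt E x₀).source}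
  have hdim : ∀ r ∈ R, dimH (f r '' Ω r) ≤ F.dim := by
    intro r hr
    have h1 : dimH (f r '' Ω r) ≤ dimH (Ω r) := by
      refine dimH_image_le_of_locally_lipschitzOn fun w hw => ?_
      have hsm : ContDiffAt ℝ 1 (f r) w := by
        have a1 : ContMDiffAt 𝓘(ℝ, A) 𝓘(ℝ, A × C) ∞ (fun w : A => (w, r.2)) w :=
          (contDiff_id.prodMk contDiff_const).contMDiff.contMDiffAt
        have a2 := (((hflat r hr).contMDiffOn_symm.contMDiffAt
          (r.1.open_target.mem_nhds hw.1)).comp w a1)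
        have a3 : ContMDiffAt 𝓘(ℝ, A) 𝓘(ℝ, E) ∞ (fun w : A => (r.1.symm (w, r.2)).1) w :=
          contMDiff_fst.contMDiffAt.comp w a2
        have a4 := (contMDiffOn_chart (I := 𝓘(ℝ, E)) (n := ∞) (x := x₀)).contMDiffAt
          ((chartAt E x₀).open_source.mem_nhds hw.2)
        exact (contMDiffAt_iff_contDiffAt.1
          (a4.comp (f := fun w : A => (r.1.symm (w, r.2)).1) w a3)).of_le (by simp)
      obtain ⟨K, t, ht, hK⟩ := hsm.exists_lipschitzOnWith
      exact ⟨K, t, mem_nhdsWithin_of_mem_nhds ht, hK⟩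
    refine h1.trans ((dimH_mono (subset_univ _)).trans ?_)
    rw [Real.dimH_univ_eq_finrank]
    simp [A]
  have hsub : (chartAt E x₀).target ⊆ ⋃ r ∈ R, f r '' Ω r := by
    intro z hz
    obtain ⟨r, hr, hs, hc⟩ := hcover _ (h ((chartAt E x₀).symm z))
    refine mem_biUnion hr ⟨(r.1 ((chartAt E x₀).symm z, (chartAt E x₀).symm z)).1, ⟨?_, ?_⟩, ?_⟩
    · rw [← hc]; exact r.1.map_source hs
    · rw [← hc, Prod.mk.eta, r.1.left_inv hs]; exact (chartAt E x₀).map_target hz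
    · simp only [f]
      rw [← hc, Prod.mk.eta, r.1.left_inv hs, (chartAt E x₀).right_inv hz]
  have h2 : dimH (chartAt E x₀).target = Module.finrank ℝ E :=
    Real.dimH_of_mem_nhds ((chartAt E x₀).open_target.mem_nhds (mem_chart_target E x₀))
  have h3 := dimH_mono hsub
  rw [h2, dimH_bUnion hR] at h3
  exact_mod_cast h3.trans (iSup₂_le hdim)

end Dimension

/-! ### Transport along the leaves -/

section Transport

variable {G M : Type*} [Group G] [MulAction G M]

/-- The value at `z` of a group element which moves `x` to `y`; for a free action there is only one
such element. -/
noncomputable def transport (G : Type*) {M : Type*} [Group G] [MulAction G M]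
    [MulAction.IsPretransitive G M] (x y z : M) : M :=
  (MulAction.exists_smul_eq G x y).choose • z

theorem transport_smul [MulAction.IsPretransitive G M]
    (hfree : ∀ (g : G) (x : M), g • x = x → g = 1) (g : G) (x z : M) :
    transport G x (g • x) z = g • z := by
  have h := (MulAction.exists_smul_eq G x (g • x)).choose_spec
  have h1 : g⁻¹ * (MulAction.exists_smul_eq G x (g • x)).choose = 1 :=
    hfree _ x (by rw [mul_smul, h, inv_smul_smul])
  rw [transport, ← inv_mul_eq_one.1 h1]

theorem transport_transport [MulAction.IsPretransitive G M]
    (hfree : ∀ (g : G) (x : M), g • x = x → g = 1) (x y z w : M) :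
    transport G z (transport G x y z) w = transport G x y w := by
  obtain ⟨g, rfl⟩ := MulAction.exists_smul_eq G x y
  rw [transport_smul hfree, transport_smul hfree, transport_smul hfree]

section Leaves

variable {E H : Type*} [NormedAddCommGroup E] [NormedSpace ℝ E] [TopologicalSpace H]
  [TopologicalSpace M] [ChartedSpace H (M × M)] {I : ModelWithCorners ℝ E H}
  {F : Foliation I (M × M)}
  (hF : Set.range (fun g : G => {p : M × M | p.2 = g • p.1}) = F.leaves)

include hF

theorem leaf_eq_graph (g : G) (x : M) : F.leaf (x, g • x) = {p : M × M | p.2 = g • p.1} := by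
  obtain ⟨p, hp⟩ : {p : M × M | p.2 = g • p.1} ∈ F.leaves := hF ▸ mem_range_self g
  have : (x, g • x) ∈ F.leaf p := by rw [hp]; rfl
  rw [F.leaf_eq_of_mem this, hp]

theorem isPretransitive_of_graphs_eq_leaves : MulAction.IsPretransitive G M := by
  refine ⟨fun x y => ?_⟩
  obtain ⟨g, hg⟩ : F.leaf (x, y) ∈ Set.range (fun g : G => {p : M × M | p.2 = g • p.1}) :=
    hF ▸ mem_range_self (x, y)
  have : (x, y) ∈ {p : M × M | p.2 = g • p.1} := by
    simp only at hg
    rw [hg]; exact F.self_mem_leaf _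
  exact ⟨g, this.symm⟩

theorem eq_one_of_graphs_eq_leaves [FaithfulSMul G M] (g : G) (x : M) (h : g • x = x) :
    g = 1 := by
  have h1 := leaf_eq_graph hF g x
  have h2 := leaf_eq_graph hF 1 x
  rw [h] at h1
  rw [one_smul] at h2
  refine FaithfulSMul.eq_of_smul_eq_smul fun y : M => ?_
  have h3 : (y, g • y) ∈ {p : M × M | p.2 = (1 : G) • p.1} := by
    rw [← h2, h1]; rfl
  exact h3

theorem transport_eq_of_mem_leaf [MulAction.IsPretransitive G M]
    (hfree : ∀ (g : G) (x : M), g • x = x → g = 1) {x y x' y' : M}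
    (h : (x', y') ∈ F.leaf (x, y)) : transport G x y x' = y' := by
  obtain ⟨g, rfl⟩ := MulAction.exists_smul_eq G x y
  rw [leaf_eq_graph hF] at h
  rw [transport_smul hfree]
  exact h.symm

end Leaves

end Transport

/-! ### Transversality to the second factor -/

section Vertical

variable {G E M : Type*} [Group G] [NormedAddCommGroup E] [NormedSpace ℝ E]
  [TopologicalSpace M] [ChartedSpace E M] [IsManifold 𝓘(ℝ, E) ∞ M] [MulAction G M]
  {F : Foliation (𝓘(ℝ, E).prod 𝓘(ℝ, E)) (M × M)}

/-- The leaves, being graphs, are nowhere tangent to the second factor. -/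
theorem eq_zero_of_fderiv_coordChart_eq_zero
    (hF : Set.range (fun g : G => {p : M × M | p.2 = g • p.1}) = F.leaves)
    (hsm : ∀ g : G, ContMDiff 𝓘(ℝ, E) 𝓘(ℝ, E) ∞ (fun x : M => g • x))
    {φ : OpenPartialHomeomorph (M × M)
      (EuclideanSpace ℝ (Fin F.dim) × EuclideanSpace ℝ (Fin F.codim))}
    (hφ : IsFlatChart (𝓘(ℝ, E).prod 𝓘(ℝ, E)) F.tangent φ) (x y : M) {z : E × E}
    (hz : z ∈ (coordChart E φ x y).source) (k : E)
    (hk : fderiv ℝ (fun z => (coordChart E φ x y z).2) z (0, k) = 0) : k = 0 := by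
  have := isPretransitive_of_graphs_eq_leaves hF
  set Φ := coordChart E φ x y with hΦ
  set κ := (chartAt E x).prod (chartAt E y) with hκ
  obtain ⟨g, hg⟩ := MulAction.exists_smul_eq G (κ.symm z).1 (κ.symm z).2
  have hgraph : F.leaf (κ.symm z) = {p : M × M | p.2 = g • p.1} := by
    rw [← leaf_eq_graph hF g (κ.symm z).1, hg]
  have hd : DifferentiableAt ℝ Φ z :=
    ((hφ.contDiffOn_coordChart x y).contDiffAt (Φ.open_source.mem_nhds hz)).differentiableAt
      (by simp)
  have hd' : DifferentiableAt ℝ Φ.symm (Φ z) :=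
    ((hφ.contDiffOn_coordChart_symm x y).contDiffAt
      (Φ.open_target.mem_nhds (Φ.map_source hz))).differentiableAt (by simp)
  -- the velocity, in the flat chart, of the curve in the plaque with initial velocity `(0, k)`
  set w := (fderiv ℝ Φ z (0, k)).1 with hw
  have hwk : fderiv ℝ Φ z (0, k) = (w, 0) := by
    refine Prod.ext rfl ?_
    rw [← hk]
    exact (DFunLike.congr_fun (hd.hasFDerivAt.snd).fderiv (0, k)).symm
  let c : ℝ → E × E := fun t => Φ.symm ((Φ z).1 + t • w, (Φ z).2)
  have hline : HasDerivAt (fun t : ℝ => ((Φ z).1 + t • w, (Φ z).2)) (w, 0) 0 := by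
    have h1 : HasDerivAt (fun t : ℝ => (Φ z).1 + t • w) w 0 := by
      simpa using ((hasDerivAt_id (0 : ℝ)).smul_const w).const_add (Φ z).1
    exact h1.prodMk (hasDerivAt_const _ _)
  have hline0 : ((Φ z).1 + (0 : ℝ) • w, (Φ z).2) = Φ z := by simp
  have hc : HasDerivAt c (0, k) 0 := by
    have h1 : HasFDerivAt Φ.symm (fderiv ℝ Φ.symm (Φ z)) ((Φ z).1 + (0 : ℝ) • w, (Φ z).2) := by
      rw [hline0]; exact hd'.hasFDerivAt
    have h2 := h1.comp_hasDerivAt (0 : ℝ) hline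
    have h3 : fderiv ℝ Φ.symm (Φ z) (w, 0) = (0, k) := by
      have h4 := hd'.hasFDerivAt.comp z hd.hasFDerivAt
      have h5 : (Φ.symm ∘ Φ) =ᶠ[𝓝 z] id := by
        filter_upwards [Φ.open_source.mem_nhds hz] with z' hz' using Φ.left_inv hz'
      have h6 := (h4.congr_of_eventuallyEq h5.symm).unique (hasFDerivAt_id z)
      rw [← hwk]
      exact DFunLike.congr_fun h6 (0, k)
    rwa [h3] at h2
  have hc0 : c 0 = z := by simp only [c, hline0, Φ.left_inv hz]
  -- the curve stays in the plaque through `z`, hence in the graph of `g`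
  have hev : ∀ᶠ t in 𝓝 (0 : ℝ), (chartAt E y) (g • (chartAt E x).symm (c t).1) = (c t).2 := by
    have hcont : ContinuousAt (fun t : ℝ => (Φ z).1 + t • w) 0 := by fun_prop
    have h0 : (Φ z).1 + (0 : ℝ) • w = (φ (κ.symm z)).1 := by simp [hΦ, coordChart, hκ]
    have e1 := hcont.eventually
      (p := fun a => φ.symm (a, (φ (κ.symm z)).2) ∈ F.leaf (κ.symm z))
      (by simp only [h0]; exact F.eventually_symm_mem_leaf hφ hz.2)
    have e2 := hline.continuousAt.eventually (p := fun a => a ∈ Φ.target)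
      (by simp only [hline0]; exact Φ.open_target.mem_nhds (Φ.map_source hz))
    filter_upwards [e1, e2] with t ht1 ht2
    rw [hgraph] at ht1
    have hmem := (Φ.map_target ht2).1
    have hct : κ.symm (c t) = φ.symm ((Φ z).1 + t • w, (Φ z).2) :=
      κ.left_inv (by exact ht2.2)
    have ht3 : (κ.symm (c t)).2 = g • (κ.symm (c t)).1 := by rw [hct]; exact ht1
    have ht4 : (chartAt E y).symm (c t).2 = g • (chartAt E x).symm (c t).1 := ht3
    rw [← ht4]
    exact (chartAt E y).right_inv hmem.2
  have hγ : DifferentiableAt ℝ (fun u => chartAt E y (g • (chartAt E x).symm u)) (c 0).1 := by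
    rw [hc0, ← mdifferentiableAt_iff_differentiableAt]
    have a1 := ((contMDiffOn_chart_symm (I := 𝓘(ℝ, E)) (n := ∞) (x := x)).contMDiffAt
      ((chartAt E x).open_target.mem_nhds hz.1.1)).mdifferentiableAt (by simp)
    have a2 := ((hsm g).contMDiffAt (x := (chartAt E x).symm z.1)).mdifferentiableAt (by simp)
    have hy : g • (chartAt E x).symm z.1 ∈ (chartAt E y).source := by
      have : g • (chartAt E x).symm z.1 = (chartAt E y).symm z.2 := hg
      rw [this]; exact (chartAt E y).map_target hz.1.2
    have a3 := ((contMDiffOn_chart (I := 𝓘(ℝ, E)) (n := ∞) (x := y)).contMDiffAt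
      ((chartAt E y).open_source.mem_nhds hy)).mdifferentiableAt (by simp)
    exact a3.comp (f := fun u => g • (chartAt E x).symm u) z.1 (a2.comp z.1 a1)
  have h1 : HasDerivAt (fun t => (c t).1) 0 0 := hc.fst
  have h2 : HasDerivAt (fun t => (c t).2) k 0 := hc.snd
  -- the second component is a differentiable function of the first one, whose velocity is zero
  have h3 := hγ.hasFDerivAt.comp_hasDerivAt (0 : ℝ) h1
  rw [map_zero] at h3
  exact (h2.congr_of_eventuallyEq hev).unique h3

end Vertical

/-! ### Local form of the transport map -/

section LocalModel

variable {G E M : Type*} [Group G] [NormedAddCommGroup E] [NormedSpace ℝ E]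
  [FiniteDimensional ℝ E] [TopologicalSpace M] [SecondCountableTopology M] [ChartedSpace E M]
  [IsManifold 𝓘(ℝ, E) ∞ M] [MulAction G M]
  {F : Foliation (𝓘(ℝ, E).prod 𝓘(ℝ, E)) (M × M)}
  (hF : Set.range (fun g : G => {p : M × M | p.2 = g • p.1}) = F.leaves)
  (hsm : ∀ g : G, ContMDiff 𝓘(ℝ, E) 𝓘(ℝ, E) ∞ (fun x : M => g • x))

include hF

theorem finrank_le_dim_of_graphs_eq_leaves [Nonempty M] : Module.finrank ℝ E ≤ F.dim := by
  obtain ⟨x₀⟩ := ‹Nonempty M›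
  refine F.finrank_le_dim x₀ fun x => ?_
  have := leaf_eq_graph hF 1 x₀
  rw [one_smul] at this
  rw [this]
  exact (one_smul G x).symm

include hsm

/-- The foliation has codimension `dim M`: at most, as the leaves have dimension at least `dim M`,
and at least, as they are transverse to the second factor. -/
theorem codim_eq_finrank [Nonempty M] : F.codim = Module.finrank ℝ E := by
  have h1 := finrank_le_dim_of_graphs_eq_leaves hF
  obtain ⟨x₀⟩ := ‹Nonempty M›
  obtain ⟨φ, hφ, hx⟩ := F.integrable (x₀, x₀)
  set Φ := coordChart E φ x₀ x₀ with hΦ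
  set p : E × E := (chartAt E x₀ x₀, chartAt E x₀ x₀) with hp
  have hz : p ∈ Φ.source := by
    simp [hΦ, coordChart, hp, hx]
  have hd : DifferentiableAt ℝ Φ p :=
    ((hφ.contDiffOn_coordChart x₀ x₀).contDiffAt (Φ.open_source.mem_nhds hz)).differentiableAt
      (by simp)
  have hd' : DifferentiableAt ℝ Φ.symm (Φ p) :=
    ((hφ.contDiffOn_coordChart_symm x₀ x₀).contDiffAt
      (Φ.open_target.mem_nhds (Φ.map_source hz))).differentiableAt (by simp)
  have h2 : F.dim + F.codim ≤ Module.finrank ℝ E + Module.finrank ℝ E := by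
    have hsurj : Function.Surjective (fderiv ℝ Φ p) := by
      intro w
      refine ⟨fderiv ℝ Φ.symm (Φ p) w, ?_⟩
      have h4 := HasFDerivAt.comp (g := Φ) (g' := fderiv ℝ Φ p) (Φ p)
        (by rw [Φ.left_inv hz]; exact hd.hasFDerivAt) hd'.hasFDerivAt
      have h5 : (Φ ∘ Φ.symm) =ᶠ[𝓝 (Φ p)] id := by
        filter_upwards [Φ.open_target.mem_nhds (Φ.map_source hz)] with z' hz'
          using Φ.right_inv hz'
      exact DFunLike.congr_fun ((h4.congr_of_eventuallyEq h5.symm).unique (hasFDerivAt_id _)) w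
    have := LinearMap.finrank_le_finrank_of_surjective (f := (fderiv ℝ Φ p).toLinearMap) hsurj
    simpa [Module.finrank_prod] using this
  have h3 : Module.finrank ℝ E ≤ F.codim := by
    have hinj : Function.Injective
        ((fderiv ℝ (fun z => (Φ z).2) p).toLinearMap ∘ₗ LinearMap.inr ℝ E E) := by
      rw [← LinearMap.ker_eq_bot, LinearMap.ker_eq_bot']
      exact fun k hk => eq_zero_of_fderiv_coordChart_eq_zero hF hsm hφ x₀ x₀ hz k hk
    simpa using LinearMap.finrank_le_finrank_of_injective hinj
  omega

/-- Near a point of `M × M`, in the charts of `M`, the leaves are the graphs `v = θ (u, c)`, where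
`c = ψ (u, v)` is the transverse component of a flat chart, and transport is given by `θ` and
`ψ`. -/
theorem exists_local_transport [MulAction.IsPretransitive G M]
    (hfree : ∀ (g : G) (x : M), g • x = x → g = 1) (x₀ y₀ : M) :
    ∃ (ψ : E × E → EuclideanSpace ℝ (Fin F.codim)) (θ : E × EuclideanSpace ℝ (Fin F.codim) → E),
      (∀ᶠ z in 𝓝 (chartAt E x₀ x₀, chartAt E y₀ y₀), ContDiffAt ℝ ∞ ψ z) ∧
      (∀ᶠ a in 𝓝 (chartAt E x₀ x₀, ψ (chartAt E x₀ x₀, chartAt E y₀ y₀)),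
        ContDiffAt ℝ ∞ θ a) ∧
      (∀ᶠ z in 𝓝 (chartAt E x₀ x₀, chartAt E y₀ y₀), θ (z.1, ψ z) = z.2) ∧
      (∀ᶠ a in 𝓝 (chartAt E x₀ x₀, ψ (chartAt E x₀ x₀, chartAt E y₀ y₀)),
        ψ (a.1, θ a) = a.2) ∧
      (∀ᶠ z in 𝓝 (chartAt E x₀ x₀, chartAt E y₀ y₀), ∀ w, fderiv ℝ ψ z w = 0 ↔
        mfderiv 𝓘(ℝ, E × E) (𝓘(ℝ, E).prod 𝓘(ℝ, E))
          ((chartAt E x₀).prod (chartAt E y₀)).symm z w ∈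
            F.tangent (((chartAt E x₀).prod (chartAt E y₀)).symm z)) ∧
      (∀ᶠ z in 𝓝 (chartAt E x₀ x₀, chartAt E y₀ y₀), ∀ k, fderiv ℝ ψ z (0, k) = 0 → k = 0) ∧
      (∀ᶠ p in 𝓝 ((chartAt E x₀ x₀, chartAt E y₀ y₀), chartAt E x₀ x₀),
        transport G ((chartAt E x₀).symm p.1.1) ((chartAt E y₀).symm p.1.2)
          ((chartAt E x₀).symm p.2) = (chartAt E y₀).symm (θ (p.2, ψ p.1))) := by
  have : Nonempty M := ⟨x₀⟩
  have hcodim := codim_eq_finrank hF hsm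
  obtain ⟨φ, hφ, hx⟩ := F.integrable (x₀, y₀)
  set Φ := coordChart E φ x₀ y₀ with hΦ
  set p₀ : E × E := (chartAt E x₀ x₀, chartAt E y₀ y₀) with hp₀
  have hp₀s : p₀ ∈ Φ.source := by simp [hΦ, coordChart, hp₀, hx]
  set ψ : E × E → EuclideanSpace ℝ (Fin F.codim) := fun z => (Φ z).2 with hψ
  have hΦn : Φ.source ∈ 𝓝 p₀ := Φ.open_source.mem_nhds hp₀s
  have hψsm : ∀ z ∈ Φ.source, ContDiffAt ℝ ∞ ψ z := fun z hz =>
    ((hφ.contDiffOn_coordChart x₀ y₀).contDiffAt (Φ.open_source.mem_nhds hz)).snd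
  have hvert : ∀ z ∈ Φ.source, ∀ k, fderiv ℝ ψ z (0, k) = 0 → k = 0 := fun z hz k hk =>
    eq_zero_of_fderiv_coordChart_eq_zero hF hsm hφ x₀ y₀ hz k hk
  have hsm' : ∀ z ∈ Φ.source, ContDiffAt ℝ ∞ (fun z : E × E => (z.1, ψ z)) z := fun z hz =>
    contDiffAt_fst.prodMk (hψsm z hz)
  have hder : ∀ z ∈ Φ.source, ∃ f' : (E × E) ≃L[ℝ] (E × EuclideanSpace ℝ (Fin F.codim)),
      HasFDerivAt (fun z : E × E => (z.1, ψ z)) (f' : _ →L[ℝ] _) z := by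
    intro z hz
    let A : (E × E) →L[ℝ] (E × EuclideanSpace ℝ (Fin F.codim)) :=
      (ContinuousLinearMap.fst ℝ E E).prod (fderiv ℝ ψ z)
    have hinj : Function.Injective A.toLinearMap := by
      rw [← LinearMap.ker_eq_bot, LinearMap.ker_eq_bot']
      rintro ⟨h, k⟩ hk
      obtain ⟨rfl, hk2⟩ : h = 0 ∧ fderiv ℝ ψ z (h, k) = 0 := by
        simpa [A, Prod.ext_iff] using hk
      rw [hvert z hz k hk2, Prod.mk_zero_zero]
    have hfr : Module.finrank ℝ (E × E) =
        Module.finrank ℝ (E × EuclideanSpace ℝ (Fin F.codim)) := by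
      simp [Module.finrank_prod, hcodim]
    refine ⟨(LinearEquiv.ofInjectiveOfFinrankEq A.toLinearMap hinj
      hfr).toContinuousLinearEquiv, ?_⟩
    have h1 : HasFDerivAt (fun z : E × E => (z.1, ψ z)) A z :=
      hasFDerivAt_fst.prodMk ((hψsm z hz).differentiableAt (by simp)).hasFDerivAt
    convert h1
    exact ContinuousLinearMap.ext fun w => rfl
  obtain ⟨f', hf'⟩ := hder p₀ hp₀s
  -- the local inverse `(u, c) ↦ (u, θ (u, c))` of `(u, v) ↦ (u, ψ (u, v))`
  let Ψ := (hsm' p₀ hp₀s).toOpenPartialHomeomorph _ hf' (by simp)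
  have hΨ : ∀ z, Ψ z = (z.1, ψ z) := fun z => rfl
  have hΨp₀ : p₀ ∈ Ψ.source := (hsm' p₀ hp₀s).mem_toOpenPartialHomeomorph_source hf' (by simp)
  let θ : E × EuclideanSpace ℝ (Fin F.codim) → E := fun a => (Ψ.symm a).2
  have hΨs : ∀ a ∈ Ψ.target, Ψ.symm a = (a.1, θ a) := by
    intro a ha
    refine Prod.ext ?_ rfl
    have := Ψ.right_inv ha
    rw [hΨ] at this
    exact (Prod.ext_iff.1 this).1
  have hN : Ψ.target ∩ Ψ.symm ⁻¹' Φ.source ∈ 𝓝 (p₀.1, ψ p₀) :=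
    (Ψ.isOpen_inter_preimage_symm Φ.open_source).mem_nhds
      ⟨Ψ.map_source hΨp₀, by
        have := Ψ.left_inv hΨp₀
        rw [hΨ] at this
        rw [mem_preimage, this]; exact hp₀s⟩
  have hθψ : ∀ z ∈ Ψ.source, θ (z.1, ψ z) = z.2 := fun z hz =>
    congrArg Prod.snd (Ψ.left_inv hz)
  refine ⟨ψ, θ, ?_, ?_, ?_, ?_, ?_, ?_, ?_⟩
  · filter_upwards [hΦn] with z hz using hψsm z hz
  · filter_upwards [hN] with a ha
    obtain ⟨f'', hf''⟩ := hder _ ha.2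
    exact (Ψ.contDiffAt_symm ha.1 hf'' (hsm' _ ha.2)).snd
  · filter_upwards [Ψ.open_source.mem_nhds hΨp₀] with z hz using hθψ z hz
  · filter_upwards [hN] with a ha
    rw [← hΨs a ha.1]
    exact congrArg Prod.snd (Ψ.right_inv ha.1)
  · filter_upwards [hΦn] with z hz w using hφ.fderiv_coordChart_eq_zero_iff x₀ y₀ hz w
  · filter_upwards [hΦn] with z hz using hvert z hz
  · obtain ⟨r, hr, hball⟩ := Metric.mem_nhds_iff.1 hN
    have hcψ : ContinuousAt (fun p : (E × E) × E => ψ p.1) (p₀, p₀.1) :=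
      ContinuousAt.comp (g := ψ) (f := Prod.fst) (x := (p₀, p₀.1))
        (hψsm p₀ hp₀s).continuousAt continuousAt_fst
    have hc1 : ContinuousAt (fun p : (E × E) × E => p.1.1) (p₀, p₀.1) := by fun_prop
    have hc2 : ContinuousAt (fun p : (E × E) × E => p.2) (p₀, p₀.1) := by fun_prop
    have hc3 : ContinuousAt (fun p : (E × E) × E => p.1) (p₀, p₀.1) := by fun_prop
    filter_upwards [hcψ (Metric.ball_mem_nhds _ hr), hc1 (Metric.ball_mem_nhds _ hr),
      hc2 (Metric.ball_mem_nhds _ hr), hc3 (Ψ.open_source.mem_nhds hΨp₀), hc3 hΦn]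
      with p h1 h2 h3 h4 h5
    have hmem : ∀ u ∈ Metric.ball p₀.1 r, (u, ψ p.1) ∈ Ψ.target ∩ Ψ.symm ⁻¹' Φ.source := by
      intro u hu
      apply hball
      rw [← ball_prod_same]
      exact ⟨hu, h1⟩
    set κ := (chartAt E x₀).prod (chartAt E y₀) with hκ
    -- the curve of points `(u, θ (u, c))` stays in the plaque through `p.1`
    have hpl : F.SamePlaque (κ.symm p.1) (κ.symm (p.2, θ (p.2, ψ p.1))) := by
      refine Foliation.SamePlaque.of_isPreconnected hφ
        (s := (fun u => κ.symm (Ψ.symm (u, ψ p.1))) '' Metric.ball p₀.1 r)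
        ((convex_ball _ r).isPreconnected.image _ ?_) ⟨p.1.1, h2, ?_⟩ ⟨p.2, h3, ?_⟩ ?_
      · refine κ.continuousOn_symm.comp (Ψ.continuousOn_symm.comp (by fun_prop)
          fun u hu => (hmem u hu).1) fun u hu => (hmem u hu).2.1
      · simp only
        rw [hΨs _ (hmem _ h2).1, hθψ _ h4]
      · simp only
        rw [hΨs _ (hmem _ h3).1]
      · rintro _ ⟨u, hu, rfl⟩
        refine ⟨(hmem u hu).2.2, ?_⟩
        have := Ψ.right_inv (hmem u hu).1
        rw [hΨ] at this
        exact (Prod.ext_iff.1 this).2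
    exact transport_eq_of_mem_leaf hF hfree (Relation.ReflTransGen.single hpl)

end LocalModel

/-! ### Propagation of smoothness -/

section Globalization

variable {𝕜 : Type*} [NontriviallyNormedField 𝕜] {G E M : Type*} [Group G]
  [NormedAddCommGroup E] [NormedSpace 𝕜 E] [TopologicalSpace M] [ChartedSpace E M]
  [MulAction G M] [MulAction.IsPretransitive G M]

/-- Smoothness of transport near `((x₀, y₀), x₀)` can be checked in the charts at `x₀` and
`y₀`. -/
theorem eventually_contMDiffAt_transport_of_coord [IsManifold 𝓘(𝕜, E) ∞ M] (x₀ y₀ : M)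
    (b : (E × E) × E → E)
    (hb : ∀ᶠ p in 𝓝 ((chartAt E x₀ x₀, chartAt E y₀ y₀), chartAt E x₀ x₀),
      ContDiffAt 𝕜 ∞ b p)
    (hb₀ : b ((chartAt E x₀ x₀, chartAt E y₀ y₀), chartAt E x₀ x₀) = chartAt E y₀ y₀)
    (h : ∀ᶠ p in 𝓝 ((chartAt E x₀ x₀, chartAt E y₀ y₀), chartAt E x₀ x₀),
        transport G ((chartAt E x₀).symm p.1.1) ((chartAt E y₀).symm p.1.2)
          ((chartAt E x₀).symm p.2) = (chartAt E y₀).symm (b p)) :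
    ∀ᶠ p in 𝓝 ((x₀, y₀), x₀), ContMDiffAt ((𝓘(𝕜, E).prod 𝓘(𝕜, E)).prod 𝓘(𝕜, E)) 𝓘(𝕜, E) ∞
      (fun p : (M × M) × M => transport G p.1.1 p.1.2 p.2) p := by
  set χ := chartAt E x₀ with hχ
  set η := chartAt E y₀ with hη
  let K : (M × M) × M → (E × E) × E := fun p => ((χ p.1.1, η p.1.2), χ p.2)
  let S : Set ((M × M) × M) := {p | (p.1.1 ∈ χ.source ∧ p.1.2 ∈ η.source) ∧ p.2 ∈ χ.source}
  have hS : IsOpen S := (χ.open_source.prod η.open_source).prod χ.open_source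
  have hS₀ : ((x₀, y₀), x₀) ∈ S :=
    ⟨⟨mem_chart_source E x₀, mem_chart_source E y₀⟩, mem_chart_source E x₀⟩
  have hK : ∀ p ∈ S, ContMDiffAt ((𝓘(𝕜, E).prod 𝓘(𝕜, E)).prod 𝓘(𝕜, E)) 𝓘(𝕜, (E × E) × E) ∞
      K p := by
    intro p hp
    have hχsm : ∀ z ∈ χ.source, ContMDiffAt 𝓘(𝕜, E) 𝓘(𝕜, E) ∞ χ z := fun z hz =>
      contMDiffOn_chart.contMDiffAt (χ.open_source.mem_nhds hz)
    have hηsm : ∀ z ∈ η.source, ContMDiffAt 𝓘(𝕜, E) 𝓘(𝕜, E) ∞ η z := fun z hz =>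
      contMDiffOn_chart.contMDiffAt (η.open_source.mem_nhds hz)
    have a1 := (hχsm _ hp.1.1).comp p (f := fun p : (M × M) × M => p.1.1)
      (contMDiffAt_fst.comp p (contMDiffAt_fst (I := 𝓘(𝕜, E).prod 𝓘(𝕜, E)) (J := 𝓘(𝕜, E))))
    have a2 := (hηsm _ hp.1.2).comp p (f := fun p : (M × M) × M => p.1.2)
      (contMDiffAt_snd.comp p (contMDiffAt_fst (I := 𝓘(𝕜, E).prod 𝓘(𝕜, E)) (J := 𝓘(𝕜, E))))
    have a3 := (hχsm _ hp.2).comp p (f := fun p : (M × M) × M => p.2)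
      (contMDiffAt_snd (I := 𝓘(𝕜, E).prod 𝓘(𝕜, E)) (J := 𝓘(𝕜, E)))
    exact (a1.prodMk_space a2).prodMk_space a3
  have hKc : ContinuousAt K ((x₀, y₀), x₀) := (hK _ hS₀).continuousAt
  have htarget : ∀ᶠ p in 𝓝 ((χ x₀, η y₀), χ x₀), b p ∈ η.target :=
    hb.self_of_nhds.continuousAt.eventually
      (by rw [hb₀]; exact η.open_target.mem_nhds (mem_chart_target E y₀))
  filter_upwards [hS.mem_nhds hS₀, hKc.eventually h.eventually_nhds, hKc.eventually hb,
    hKc.eventually htarget] with p hpS hp1 hp2 hp3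
  have hsm : ContMDiffAt ((𝓘(𝕜, E).prod 𝓘(𝕜, E)).prod 𝓘(𝕜, E)) 𝓘(𝕜, E) ∞
      (fun p => η.symm (b (K p))) p :=
    ((contMDiffOn_chart_symm (I := 𝓘(𝕜, E)) (n := ∞) (x := y₀)).contMDiffAt
      (η.open_target.mem_nhds hp3)).comp p (f := fun p => b (K p))
      (hp2.contMDiffAt.comp p (hK p hpS))
  refine hsm.congr_of_eventuallyEq ?_
  filter_upwards [hS.mem_nhds hpS, (hK p hpS).continuousAt.eventually hp1] with p' hp'S hp'
  rw [← hp']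
  simp only [K, χ.left_inv hp'S.1.1, η.left_inv hp'S.1.2, χ.left_inv hp'S.2]

/-- Transport is smooth as soon as it is smooth near all points `((x₀, y₀), x₀)`: the
composition rule `transport z (transport x y z) w = transport x y w` propagates smoothness in the
last variable, and `M` is connected. -/
theorem contMDiff_transport_of_eventually [ConnectedSpace M]
    (hfree : ∀ (g : G) (x : M), g • x = x → g = 1) (hcont : ∀ g : G, Continuous fun x : M => g • x)
    (h : ∀ x₀ y₀ : M, ∀ᶠ p in 𝓝 ((x₀, y₀), x₀),
      ContMDiffAt ((𝓘(𝕜, E).prod 𝓘(𝕜, E)).prod 𝓘(𝕜, E)) 𝓘(𝕜, E) ∞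
        (fun p : (M × M) × M => transport G p.1.1 p.1.2 p.2) p) :
    ContMDiff ((𝓘(𝕜, E).prod 𝓘(𝕜, E)).prod 𝓘(𝕜, E)) 𝓘(𝕜, E) ∞
      (fun p : (M × M) × M => transport G p.1.1 p.1.2 p.2) := by
  rintro ⟨⟨x, y⟩, z⟩
  obtain ⟨g, rfl⟩ := MulAction.exists_smul_eq G x y
  let P : (M × M) × M → Prop := fun p =>
    ContMDiffAt ((𝓘(𝕜, E).prod 𝓘(𝕜, E)).prod 𝓘(𝕜, E)) 𝓘(𝕜, E) ∞
        (fun p : (M × M) × M => transport G p.1.1 p.1.2 p.2) p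
  -- `transport x y w = transport u (transport x y u) w`
  have key : ∀ u w, P ((u, g • u), w) → P ((x, g • x), u) → P ((x, g • x), w) := by
    intro u w h1 h2
    have a1 : ContMDiffAt ((𝓘(𝕜, E).prod 𝓘(𝕜, E)).prod 𝓘(𝕜, E))
        ((𝓘(𝕜, E).prod 𝓘(𝕜, E)).prod 𝓘(𝕜, E)) ∞ (fun p : (M × M) × M => (p.1, u))
          ((x, g • x), w) := contMDiffAt_fst.prodMk contMDiffAt_const
    have a2 : ContMDiffAt ((𝓘(𝕜, E).prod 𝓘(𝕜, E)).prod 𝓘(𝕜, E)) 𝓘(𝕜, E) ∞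
        (fun p : (M × M) × M => transport G p.1.1 p.1.2 u) ((x, g • x), w) :=
      ContMDiffAt.comp (g := fun p : (M × M) × M => transport G p.1.1 p.1.2 p.2)
        (f := fun p : (M × M) × M => (p.1, u)) ((x, g • x), w) h2 a1
    have a3 : ContMDiffAt ((𝓘(𝕜, E).prod 𝓘(𝕜, E)).prod 𝓘(𝕜, E))
        ((𝓘(𝕜, E).prod 𝓘(𝕜, E)).prod 𝓘(𝕜, E)) ∞
        (fun p : (M × M) × M => ((u, transport G p.1.1 p.1.2 u), p.2)) ((x, g • x), w) :=
      (contMDiffAt_const.prodMk a2).prodMk contMDiffAt_snd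
    have a4 := ContMDiffAt.comp (g := fun p : (M × M) × M => transport G p.1.1 p.1.2 p.2)
      (f := fun p : (M × M) × M => ((u, transport G p.1.1 p.1.2 u), p.2)) ((x, g • x), w)
      (by simp only [transport_smul hfree]; exact h1) a3
    refine a4.congr_of_eventuallyEq (Eventually.of_forall fun p => ?_)
    exact (transport_transport hfree _ _ _ _).symm
  refine (isPreconnected_univ.induction₂
    (fun u w => (P ((x, g • x), u) ↔ P ((x, g • x), w))) ?_ (fun _ _ _ _ _ _ => Iff.trans)
    (fun _ _ _ _ => Iff.symm) (mem_univ x) (mem_univ z)).1 (h x (g • x)).self_of_nhds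
  intro u _
  rw [nhdsWithin_univ]
  have c1 : ContinuousAt (fun w : M => ((u, g • u), w)) u := by fun_prop
  have c2 : ContinuousAt (fun w : M => ((w, g • w), u)) u := by
    have := hcont g
    fun_prop
  filter_upwards [c1.eventually (h u (g • u)), c2.eventually (h u (g • u))] with w h1 h2
  exact ⟨key u w h1, key w u h2⟩

end Globalization

section RealSmoothness

variable {G E M : Type*} [Group G] [NormedAddCommGroup E] [NormedSpace ℝ E]
  [FiniteDimensional ℝ E] [TopologicalSpace M] [SecondCountableTopology M] [ConnectedSpace M]
  [ChartedSpace E M] [IsManifold 𝓘(ℝ, E) ∞ M] [MulAction G M] [MulAction.IsPretransitive G M]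
  {F : Foliation (𝓘(ℝ, E).prod 𝓘(ℝ, E)) (M × M)}

theorem contMDiff_transport
    (hF : Set.range (fun g : G => {p : M × M | p.2 = g • p.1}) = F.leaves)
    (hsm : ∀ g : G, ContMDiff 𝓘(ℝ, E) 𝓘(ℝ, E) ∞ (fun x : M => g • x))
    (hfree : ∀ (g : G) (x : M), g • x = x → g = 1) :
    ContMDiff ((𝓘(ℝ, E).prod 𝓘(ℝ, E)).prod 𝓘(ℝ, E)) 𝓘(ℝ, E) ∞
      (fun p : (M × M) × M => transport G p.1.1 p.1.2 p.2) := by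
  refine contMDiff_transport_of_eventually hfree (fun g => (hsm g).continuous) fun x₀ y₀ => ?_
  obtain ⟨ψ, θ, hψ, hθ, hθψ, -, -, -, htr⟩ := exists_local_transport hF hsm hfree x₀ y₀
  refine eventually_contMDiffAt_transport_of_coord x₀ y₀ (fun p => θ (p.2, ψ p.1)) ?_
    hθψ.self_of_nhds htr
  have c1 : ContinuousAt (fun p : (E × E) × E => p.1)
    ((chartAt E x₀ x₀, chartAt E y₀ y₀), chartAt E x₀ x₀) := by fun_prop
  have c2 : ContinuousAt (fun p : (E × E) × E => (p.2, ψ p.1))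
      ((chartAt E x₀ x₀, chartAt E y₀ y₀), chartAt E x₀ x₀) :=
    continuousAt_snd.prodMk (ContinuousAt.comp (g := ψ) (f := Prod.fst)
      (x := ((chartAt E x₀ x₀, chartAt E y₀ y₀), chartAt E x₀ x₀))
      hψ.self_of_nhds.continuousAt continuousAt_fst)
  filter_upwards [c1.eventually hψ, c2.eventually hθ] with p h1 h2
  exact h2.comp p (contDiffAt_snd.prodMk (h1.comp p contDiffAt_fst))

end RealSmoothness

theorem bijective_smul_of_free {G M : Type*} [Group G] [MulAction G M]
    [MulAction.IsPretransitive G M]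
    (hfree : ∀ (g : G) (x : M), g • x = x → g = 1) (x₀ : M) :
    Function.Bijective fun g : G => g • x₀ := by
  refine ⟨fun g g' h => ?_, MulAction.exists_smul_eq G x₀⟩
  refine (inv_mul_eq_one.1 (hfree (g⁻¹ * g') x₀ ?_))
  rw [mul_smul, ← show g • x₀ = g' • x₀ from h, inv_smul_smul]

/-! ### Transporting an atlas along a homeomorphism -/

section PullbackManifold

variable {𝕜 : Type*} [NontriviallyNormedField 𝕜] {E M N : Type*} [NormedAddCommGroup E]
  [NormedSpace 𝕜 E] [TopologicalSpace M] [ChartedSpace E M] [TopologicalSpace N]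

/-- The atlas obtained by transporting the atlas of `M` along a homeomorphism `N ≃ₜ M`. -/
abbrev Homeomorph.pullbackChartedSpace (E : Type*) {M N : Type*} [TopologicalSpace E]
    [TopologicalSpace M] [ChartedSpace E M] [TopologicalSpace N] (h : N ≃ₜ M) :
    ChartedSpace E N where
  atlas := (fun χ => h.toOpenPartialHomeomorph.trans χ) '' atlas E M
  chartAt x := h.toOpenPartialHomeomorph.trans (chartAt E (h x))
  mem_chart_source x := by simp
  chart_mem_atlas x := ⟨_, chart_mem_atlas E (h x), rfl⟩

theorem Homeomorph.isManifold_pullback [IsManifold 𝓘(𝕜, E) ∞ M] (h : N ≃ₜ M) :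
    letI := h.pullbackChartedSpace E
    IsManifold 𝓘(𝕜, E) ∞ N := by
  let := h.pullbackChartedSpace E
  have : HasGroupoid N (contDiffGroupoid ∞ 𝓘(𝕜, E)) := by
    constructor
    rintro _ _ ⟨χ, hχ, rfl⟩ ⟨χ', hχ', rfl⟩
    have : (h.toOpenPartialHomeomorph.trans χ).symm.trans (h.toOpenPartialHomeomorph.trans χ') =
        χ.symm.trans χ' := by
      refine OpenPartialHomeomorph.ext _ _ (fun x => ?_) (fun x => ?_) ?_
      · simp
      · simp
      · ext x; simp
    rw [this]
    exact HasGroupoid.compatible hχ hχ'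
  exact ⟨⟩

theorem Homeomorph.contMDiff_pullback (h : N ≃ₜ M) :
    letI := h.pullbackChartedSpace E
    ContMDiff 𝓘(𝕜, E) 𝓘(𝕜, E) ∞ h := by
  let := h.pullbackChartedSpace E
  have hchart : ∀ x : N, chartAt E x = h.toOpenPartialHomeomorph.trans (chartAt E (h x)) :=
    fun _ => rfl
  intro x
  rw [contMDiffAt_iff]
  refine ⟨h.continuous.continuousAt, ?_⟩
  have hx : extChartAt 𝓘(𝕜, E) x x ∈ (chartAt E (h x)).target := by
    simp [hchart]
  refine contDiffWithinAt_id.congr_of_eventuallyEq_of_mem ?_ (by simp)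
  filter_upwards [mem_nhdsWithin_of_mem_nhds ((chartAt E (h x)).open_target.mem_nhds hx)]
    with z hz
  simp_all

theorem Homeomorph.contMDiff_symm_pullback (h : N ≃ₜ M) :
    letI := h.pullbackChartedSpace E
    ContMDiff 𝓘(𝕜, E) 𝓘(𝕜, E) ∞ h.symm := by
  let := h.pullbackChartedSpace E
  have hchart : ∀ x : N, chartAt E x = h.toOpenPartialHomeomorph.trans (chartAt E (h x)) :=
    fun _ => rfl
  intro x
  rw [contMDiffAt_iff]
  refine ⟨h.symm.continuous.continuousAt, ?_⟩
  have hx : extChartAt 𝓘(𝕜, E) x x ∈ (chartAt E x).target := by simp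
  refine contDiffWithinAt_id.congr_of_eventuallyEq_of_mem ?_ (by simp)
  filter_upwards [mem_nhdsWithin_of_mem_nhds ((chartAt E x).open_target.mem_nhds hx)]
    with z hz
  simp_all

end PullbackManifold

/-! ### Existence of the Lie group structure -/

section Existence

variable {𝕜 : Type*} [RCLike 𝕜] {G E M : Type*} [Group G]
  [NormedAddCommGroup E] [NormedSpace 𝕜 E] [TopologicalSpace M] [T2Space M]
  [SecondCountableTopology M] [ChartedSpace E M] [IsManifold 𝓘(𝕜, E) ∞ M]
  [MulAction G M] [MulAction.IsPretransitive G M]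

/-- If transport is smooth, then the manifold structure of `M`, pulled back along an orbit map,
makes `G` a Lie group acting smoothly on `M`. -/
theorem exists_lieGroupStructure (hfree : ∀ (g : G) (x : M), g • x = x → g = 1) (x₀ : M)
    (h : ContMDiff ((𝓘(𝕜, E).prod 𝓘(𝕜, E)).prod 𝓘(𝕜, E)) 𝓘(𝕜, E) ∞
      (fun p : (M × M) × M => transport G p.1.1 p.1.2 p.2)) :
    ∃ S : LieGroupStructure 𝕜 E G, S.ActsSmoothlyOn M := by
  let e : G ≃ M := Equiv.ofBijective _ (bijective_smul_of_free hfree x₀)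
  let : TopologicalSpace G := TopologicalSpace.induced e inferInstance
  let o : G ≃ₜ M := e.toHomeomorphOfIsInducing ⟨rfl⟩
  have ho : ∀ g, o g = g • x₀ := fun g => rfl
  let : ChartedSpace E G := o.pullbackChartedSpace E
  have : IsManifold 𝓘(𝕜, E) ∞ G := o.isManifold_pullback
  have hsm : ContMDiff 𝓘(𝕜, E) 𝓘(𝕜, E) ∞ o := o.contMDiff_pullback
  have hsm' : ContMDiff 𝓘(𝕜, E) 𝓘(𝕜, E) ∞ o.symm := o.contMDiff_symm_pullback
  have hact : ContMDiff (𝓘(𝕜, E).prod 𝓘(𝕜, E)) 𝓘(𝕜, E) ∞ (fun p : G × M => p.1 • p.2) := by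
    have h1 : ContMDiff (𝓘(𝕜, E).prod 𝓘(𝕜, E)) ((𝓘(𝕜, E).prod 𝓘(𝕜, E)).prod 𝓘(𝕜, E)) ∞
        (fun p : G × M => ((x₀, o p.1), p.2)) :=
      (contMDiff_const.prodMk (hsm.comp contMDiff_fst)).prodMk contMDiff_snd
    refine (h.comp h1).congr fun p => ?_
    exact (transport_smul hfree p.1 x₀ p.2).symm
  have hmul : ContMDiff (𝓘(𝕜, E).prod 𝓘(𝕜, E)) 𝓘(𝕜, E) ∞ (fun p : G × G => p.1 * p.2) := by
    have h1 : ContMDiff (𝓘(𝕜, E).prod 𝓘(𝕜, E)) (𝓘(𝕜, E).prod 𝓘(𝕜, E)) ∞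
        (fun p : G × G => (p.1, o p.2)) := contMDiff_fst.prodMk (hsm.comp contMDiff_snd)
    refine (hsm'.comp (hact.comp h1)).congr fun p => ?_
    rw [Function.comp_apply, eq_comm, Homeomorph.symm_apply_eq, ho, Function.comp_apply, ho,
      mul_smul]
  have hinv : ContMDiff 𝓘(𝕜, E) 𝓘(𝕜, E) ∞ (fun g : G => g⁻¹) := by
    have h1 : ContMDiff 𝓘(𝕜, E) ((𝓘(𝕜, E).prod 𝓘(𝕜, E)).prod 𝓘(𝕜, E)) ∞
        (fun g : G => ((o g, x₀), x₀)) :=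
      (hsm.prodMk contMDiff_const).prodMk contMDiff_const
    refine (hsm'.comp (h.comp h1)).congr fun g => ?_
    rw [Function.comp_apply, eq_comm, Homeomorph.symm_apply_eq, ho, Function.comp_apply]
    have := transport_smul hfree g⁻¹ (g • x₀) x₀
    rwa [inv_smul_smul] at this
  have : LieGroup 𝓘(𝕜, E) ∞ G := { contMDiff_mul := hmul, contMDiff_inv := hinv }
  have : T2Space G := o.symm.t2Space
  have : SecondCountableTopology G := o.secondCountableTopology
  exact ⟨{}, hact⟩

end Existence

/-! ### Uniqueness of the Lie group structure -/

section Uniqueness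

variable {𝕜 : Type*} [RCLike 𝕜] {G E M : Type*} [Group G]
  [NormedAddCommGroup E] [NormedSpace 𝕜 E] [NormedSpace ℝ E] [IsScalarTower ℝ 𝕜 E]
  [FiniteDimensional ℝ E] [TopologicalSpace M] [ChartedSpace E M] [IsManifold 𝓘(𝕜, E) ∞ M]
  [TopologicalSpace G] [ChartedSpace E G]

omit [Group G] in
/-- A smooth surjection between manifolds of the same dimension, the first one second countable,
has an injective derivative at some point: otherwise its image would have measure zero in charts
of the target. -/
theorem exists_injective_mfderiv_of_surjective [SecondCountableTopology G] [Nonempty M]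
    [IsManifold 𝓘(𝕜, E) ∞ G] {f : G → M}
    (hf : ContMDiff 𝓘(𝕜, E) 𝓘(𝕜, E) ∞ f) (hsurj : Function.Surjective f) :
    ∃ g, Function.Injective (mfderiv 𝓘(𝕜, E) 𝓘(𝕜, E) f g) := by
  by_contra! hcon
  obtain ⟨x₀⟩ := ‹Nonempty M›
  have : IsManifold 𝓘(𝕜, E) 1 G := IsManifold.of_le (n := ∞) (by simp)
  have : IsManifold 𝓘(𝕜, E) 1 M := IsManifold.of_le (n := ∞) (by simp)
  obtain ⟨s, hs, hcover⟩ := TopologicalSpace.countable_cover_nhds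
    (fun g : G => (chartAt E g).open_source.mem_nhds (mem_chart_source E g))
  set χ := chartAt E x₀ with hχ
  let : MeasurableSpace E := borel E
  have : BorelSpace E := ⟨rfl⟩
  let μ : MeasureTheory.Measure E := MeasureTheory.Measure.addHaar
  let Ω : G → Set E :=
    fun g => {u | u ∈ (chartAt E g).target ∧ f ((chartAt E g).symm u) ∈ χ.source}
  let F : G → E → E := fun g u => χ (f ((chartAt E g).symm u))
  have hzero : ∀ g, μ (F g '' Ω g) = 0 := by
    intro g
    have hder : ∀ u ∈ Ω g, DifferentiableAt 𝕜 (F g) u ∧ ∃ w, w ≠ 0 ∧ fderiv 𝕜 (F g) u w = 0 := by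
      rintro u ⟨hu, hfu⟩
      have hc := mdifferentiable_chart (I := 𝓘(𝕜, E)) g
      have d1 : MDifferentiableAt 𝓘(𝕜, E) 𝓘(𝕜, E) (chartAt E g).symm u :=
        hc.mdifferentiableAt_symm hu
      have d2 : MDifferentiableAt 𝓘(𝕜, E) 𝓘(𝕜, E) f ((chartAt E g).symm u) :=
        hf.mdifferentiableAt (by simp)
      have d3 : MDifferentiableAt 𝓘(𝕜, E) 𝓘(𝕜, E) χ (f ((chartAt E g).symm u)) :=
        (mdifferentiable_chart (I := 𝓘(𝕜, E)) x₀).mdifferentiableAt hfu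
      have d4 := d2.comp u d1
      refine ⟨(d3.comp (f := fun u => f ((chartAt E g).symm u)) u d4).differentiableAt, ?_⟩
      have hni := hcon ((chartAt E g).symm u)
      obtain ⟨v, hv0, hv⟩ : ∃ v : E, v ≠ 0 ∧
          mfderiv 𝓘(𝕜, E) 𝓘(𝕜, E) f ((chartAt E g).symm u) v = 0 := by
        by_contra! hne
        refine hni ((injective_iff_map_eq_zero _).2 fun v hv => ?_)
        by_contra hv0
        exact hne v hv0 hv
      have hid := hc.symm_comp_deriv ((chartAt E g).map_target hu)
      rw [(chartAt E g).right_inv hu] at hid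
      have hidv : mfderiv 𝓘(𝕜, E) 𝓘(𝕜, E) (chartAt E g).symm u
          (mfderiv 𝓘(𝕜, E) 𝓘(𝕜, E) (chartAt E g) ((chartAt E g).symm u) v) = v :=
        DFunLike.congr_fun hid v
      refine ⟨mfderiv 𝓘(𝕜, E) 𝓘(𝕜, E) (chartAt E g) ((chartAt E g).symm u) v, ?_, ?_⟩
      · intro h0
        apply hv0
        rw [← hidv]
        erw [h0]
        exact map_zero _
      · rw [← mfderiv_eq_fderiv]
        have e1 := mfderiv_comp_apply (g := χ) (f := fun u => f ((chartAt E g).symm u)) u d3 d4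
          (mfderiv 𝓘(𝕜, E) 𝓘(𝕜, E) (chartAt E g) ((chartAt E g).symm u) v)
        have e2 := mfderiv_comp_apply (g := f) (f := (chartAt E g).symm) u d2 d1
          (mfderiv 𝓘(𝕜, E) 𝓘(𝕜, E) (chartAt E g) ((chartAt E g).symm u) v)
        rw [hidv] at e2
        refine e1.trans ?_
        erw [e2, hv]
        exact map_zero _
    refine MeasureTheory.addHaar_image_eq_zero_of_det_fderivWithin_eq_zero μ
      (f' := fun u => (fderiv 𝕜 (F g) u).restrictScalars ℝ)
      (fun u hu => ((hder u hu).1.hasFDerivAt.restrictScalars ℝ).hasFDerivWithinAt)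
      fun u hu => ?_
    obtain ⟨w, hw0, hw⟩ := (hder u hu).2
    by_contra hdet
    have hker := LinearMap.ker_eq_bot'.1 (LinearMap.ker_eq_bot.2
      (LinearMap.equivOfDetNeZero ((fderiv 𝕜 (F g) u).restrictScalars ℝ).toLinearMap
        hdet).injective) w
    exact hw0 (hker hw)
  have hsub : χ.target ⊆ ⋃ g ∈ s, F g '' Ω g := by
    intro z hz
    obtain ⟨a, ha⟩ := hsurj (χ.symm z)
    obtain ⟨g, hg, hag⟩ := mem_iUnion₂.1
      (hcover.symm ▸ mem_univ a : a ∈ ⋃ g ∈ s, (chartAt E g).source)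
    refine mem_biUnion hg ⟨chartAt E g a, ⟨(chartAt E g).map_source hag, ?_⟩, ?_⟩
    · rw [(chartAt E g).left_inv hag, ha]; exact χ.map_target hz
    · simp only [F]
      rw [(chartAt E g).left_inv hag, ha, χ.right_inv hz]
  have hpos : 0 < μ χ.target := χ.open_target.measure_pos μ ⟨_, mem_chart_target E x₀⟩
  exact hpos.ne' (MeasureTheory.measure_mono_null hsub
    ((MeasureTheory.measure_biUnion_null_iff hs).2 fun g _ => hzero g))

omit [NormedSpace ℝ E] [IsScalarTower ℝ 𝕜 E] [FiniteDimensional ℝ E] [Group G] in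
/-- The inverse of a smooth bijection with injective derivatives is smooth. -/
theorem Equiv.contMDiff_symm_of_injective_mfderiv [FiniteDimensional 𝕜 E]
    [IsManifold 𝓘(𝕜, E) ∞ G] (e : G ≃ M) (he : ContMDiff 𝓘(𝕜, E) 𝓘(𝕜, E) ∞ e)
    (hinj : ∀ g, Function.Injective (mfderiv 𝓘(𝕜, E) 𝓘(𝕜, E) e g)) :
    ContMDiff 𝓘(𝕜, E) 𝓘(𝕜, E) ∞ e.symm := by
  intro x
  obtain ⟨g, rfl⟩ := e.surjective x
  have : CompleteSpace E := FiniteDimensional.complete 𝕜 E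
  set c := chartAt E g with hc
  set χ := chartAt E (e g) with hχ
  let f : E → E := fun u => χ (e (c.symm u))
  have hf : ContDiffAt 𝕜 ∞ f (c g) := by
    rw [← contMDiffAt_iff_contDiffAt]
    have h1 : ContMDiffAt 𝓘(𝕜, E) 𝓘(𝕜, E) ∞ c.symm (c g) :=
      contMDiffOn_chart_symm.contMDiffAt (c.open_target.mem_nhds (mem_chart_target E g))
    have h2 : ContMDiffAt 𝓘(𝕜, E) 𝓘(𝕜, E) ∞ χ (e (c.symm (c g))) := by
      rw [c.left_inv (mem_chart_source E g)]
      exact contMDiffOn_chart.contMDiffAt (χ.open_source.mem_nhds (mem_chart_source E _))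
    exact h2.comp (f := fun u => e (c.symm u)) (c g) (he.contMDiffAt.comp (c g) h1)
  let D : E →L[𝕜] E := mfderiv 𝓘(𝕜, E) 𝓘(𝕜, E) e g
  have hder : HasFDerivAt f D (c g) := by
    have := (he.mdifferentiableAt (x := g) (by simp)).hasMFDerivAt.2
    simp only [writtenInExtChartAt, Function.comp_def, mfld_simps] at this
    exact (hasFDerivWithinAt_univ (f' := D)).1 this
  let A : E ≃L[𝕜] E :=
    (LinearEquiv.ofInjectiveEndo D.toLinearMap (hinj g)).toContinuousLinearEquiv
  have hAD : (A : E →L[𝕜] E) = D := ContinuousLinearMap.ext fun w => rfl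
  have hA : HasFDerivAt f (A : E →L[𝕜] E) (c g) := hAD ▸ hder
  let Ψ := hf.toOpenPartialHomeomorph f hA (by simp)
  have hΨ : ∀ u, Ψ u = f u := fun u => rfl
  have hcg : c g ∈ Ψ.source := hf.mem_toOpenPartialHomeomorph_source hA (by simp)
  have hfcg : f (c g) = χ (e g) := by simp only [f, c.left_inv (mem_chart_source E g)]
  have hχt : χ (e g) ∈ Ψ.target := by rw [← hfcg, ← hΨ]; exact Ψ.map_source hcg
  have hΨs : Ψ.symm (χ (e g)) = c g := by rw [← hfcg, ← hΨ, Ψ.left_inv hcg]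
  have hsymm : ContDiffAt 𝕜 ∞ Ψ.symm (χ (e g)) :=
    Ψ.contDiffAt_symm hχt (by rw [hΨs]; exact hA) (by rw [hΨs]; exact hf)
  have hχsm : ContMDiffAt 𝓘(𝕜, E) 𝓘(𝕜, E) ∞ χ (e g) :=
    contMDiffOn_chart.contMDiffAt (χ.open_source.mem_nhds (mem_chart_source E _))
  have hcomp : ContMDiffAt 𝓘(𝕜, E) 𝓘(𝕜, E) ∞ (fun y => c.symm (Ψ.symm (χ y))) (e g) := by
    have h1 : ContMDiffAt 𝓘(𝕜, E) 𝓘(𝕜, E) ∞ c.symm (Ψ.symm (χ (e g))) := by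
      rw [hΨs]
      exact contMDiffOn_chart_symm.contMDiffAt (c.open_target.mem_nhds (mem_chart_target E g))
    exact h1.comp (f := fun y => Ψ.symm (χ y)) (e g) (hsymm.contMDiffAt.comp (e g) hχsm)
  refine hcomp.congr_of_eventuallyEq ?_
  have h3 : ContinuousAt (fun y => e (c.symm (Ψ.symm (χ y)))) (e g) := by
    exact he.continuous.continuousAt.comp (f := fun y => c.symm (Ψ.symm (χ y)))
      hcomp.continuousAt
  have h4 : ∀ᶠ y in 𝓝 (e g), e (c.symm (Ψ.symm (χ y))) ∈ χ.source := by
    refine h3.eventually (p := fun z => z ∈ χ.source) (χ.open_source.mem_nhds ?_)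
    simp only [hΨs, c.left_inv (mem_chart_source E g)]
    exact mem_chart_source E _
  filter_upwards [h4, χ.open_source.mem_nhds (mem_chart_source E (e g)),
    hχsm.continuousAt.eventually (Ψ.open_target.mem_nhds hχt)] with y h4 h5 h6
  rw [Equiv.symm_apply_eq]
  refine (χ.injOn h4 h5 ?_).symm
  have := Ψ.right_inv h6
  rwa [hΨ] at this

/-- For a smooth free transitive action of a Lie group on a manifold of the same dimension, the
inverse of an orbit map is smooth. By equivariance the orbit map has constant rank, which must be
maximal. -/
theorem contMDiff_orbit_symm [SecondCountableTopology G] [LieGroup 𝓘(𝕜, E) ∞ G] [MulAction G M]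
    (hact : ContMDiff (𝓘(𝕜, E).prod 𝓘(𝕜, E)) 𝓘(𝕜, E) ∞ (fun p : G × M => p.1 • p.2)) (x₀ : M)
    (e : G ≃ M) (he : ∀ g, e g = g • x₀) : ContMDiff 𝓘(𝕜, E) 𝓘(𝕜, E) ∞ e.symm := by
  have : Nonempty M := ⟨x₀⟩
  have : FiniteDimensional 𝕜 E := Module.Finite.right ℝ 𝕜 E
  have hesm : ContMDiff 𝓘(𝕜, E) 𝓘(𝕜, E) ∞ e := by
    have h1 : ContMDiff 𝓘(𝕜, E) (𝓘(𝕜, E).prod 𝓘(𝕜, E)) ∞ (fun g : G => (g, x₀)) :=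
      contMDiff_id.prodMk contMDiff_const
    exact (hact.comp h1).congr he
  have hρ : ∀ a : G, ContMDiff 𝓘(𝕜, E) 𝓘(𝕜, E) ∞ fun x : M => a • x := fun a => by
    have h1 : ContMDiff 𝓘(𝕜, E) (𝓘(𝕜, E).prod 𝓘(𝕜, E)) ∞ (fun x : M => (a, x)) :=
      contMDiff_const.prodMk contMDiff_id
    exact hact.comp h1
  obtain ⟨g₀, hg₀⟩ := exists_injective_mfderiv_of_surjective hesm e.surjective
  refine e.contMDiff_symm_of_injective_mfderiv hesm fun g => ?_
  have hL : ∀ a b : G, MDifferentiableAt 𝓘(𝕜, E) 𝓘(𝕜, E) (fun x => a * x) b := fun a b =>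
    (contMDiff_mul_left (I := 𝓘(𝕜, E)) (n := ∞)).mdifferentiableAt (by simp)
  let a : G := g₀ * g⁻¹
  have hag : a * g = g₀ := by simp [a]
  have hed : ∀ b, MDifferentiableAt 𝓘(𝕜, E) 𝓘(𝕜, E) e b := fun b =>
    hesm.mdifferentiableAt (by simp)
  -- differentiating this identity shows that the rank at `g` is the rank at `g₀`
  have hcomm : (fun x : M => a • x) ∘ e = e ∘ fun x => a * x := by
    ext b; simp [he, mul_smul]
  refine (injective_iff_map_eq_zero _).2 fun v hv => ?_
  have e1 := mfderiv_comp_apply g ((hρ a).mdifferentiableAt (by simp)) (hed g) v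
  have e2 := mfderiv_comp_apply (f := fun x => a * x) g (hed (a * g)) (hL a g) v
  rw [hv, map_zero, hcomm] at e1
  rw [e1] at e2
  have e3 : mfderiv 𝓘(𝕜, E) 𝓘(𝕜, E) (fun x => a * x) g v = 0 := by
    have hinj : Function.Injective (mfderiv 𝓘(𝕜, E) 𝓘(𝕜, E) e (a * g)) := by
      rw [hag]; exact hg₀
    exact hinj (e2.symm.trans (map_zero _).symm)
  have e4 := mfderiv_comp_apply (g := fun x => a⁻¹ * x) (f := fun x => a * x) g
    (hL a⁻¹ (a * g)) (hL a g) v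
  have e5 : ((fun x => a⁻¹ * x) ∘ fun x => a * x) = id := by ext; simp
  rw [e5, e3, map_zero, mfderiv_id] at e4
  exact e4

omit [TopologicalSpace G] [ChartedSpace E G] in
/-- Any two Lie group structures for which a free transitive action on `M` is smooth are compared
through an orbit map, which identifies both with `M`. -/
theorem LieGroupStructure.idContMDiff_of_actsSmoothlyOn [MulAction G M]
    [MulAction.IsPretransitive G M] (hfree : ∀ (g : G) (x : M), g • x = x → g = 1) (x₀ : M)
    (S T : LieGroupStructure 𝕜 E G) (hS : S.ActsSmoothlyOn M) (hT : T.ActsSmoothlyOn M) :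
    S.IdContMDiff T := by
  let e : G ≃ M := Equiv.ofBijective _ (bijective_smul_of_free hfree x₀)
  have he : ∀ g, e g = g • x₀ := fun g => rfl
  have h1 : @ContMDiff 𝕜 _ E _ _ E _ 𝓘(𝕜, E) G S.topology S.charts
      E _ _ E _ 𝓘(𝕜, E) M _ _ ∞ e := by
    let := S.topology
    let := S.charts
    have h1 : ContMDiff 𝓘(𝕜, E) (𝓘(𝕜, E).prod 𝓘(𝕜, E)) ∞ (fun g : G => (g, x₀)) :=
      contMDiff_id.prodMk contMDiff_const
    exact ContMDiff.comp (g := fun p : G × M => p.1 • p.2) hS h1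
  have h2 : @ContMDiff 𝕜 _ E _ _ E _ 𝓘(𝕜, E) M _ _
      E _ _ E _ 𝓘(𝕜, E) G T.topology T.charts ∞ e.symm := by
    let := T.topology
    let := T.charts
    have := T.secondCountable
    have := T.lieGroup
    exact contMDiff_orbit_symm hT x₀ e he
  let := S.topology
  let := S.charts
  have h3 := @ContMDiff.comp 𝕜 _ E _ _ E _ 𝓘(𝕜, E) G S.topology E _ _ E _ 𝓘(𝕜, E) M _
    E _ _ E _ 𝓘(𝕜, E) G T.topology S.charts _ T.charts e ∞ e.symm h2 h1
  rwa [Equiv.symm_comp_self] at h3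

end Uniqueness

/-! ### From real to complex smoothness -/

section RealToComplex

variable {E F : Type*} [NormedAddCommGroup E] [NormedSpace ℂ E] [NormedAddCommGroup F]
  [NormedSpace ℂ F]

theorem ContinuousLinearMap.exists_restrictScalars_eq (D : E →L[ℝ] F)
    (hD : ∀ v, D (Complex.I • v) = Complex.I • D v) :
    ∃ D' : E →L[ℂ] F, D'.restrictScalars ℝ = D := by
  refine ⟨⟨{ toFun := D, map_add' := D.map_add, map_smul' := fun z v => ?_ }, D.cont⟩, rfl⟩
  have h : ∀ {V : Type _} [NormedAddCommGroup V] [NormedSpace ℂ V] (v : V),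
      z • v = z.re • v + z.im • Complex.I • v := by
    intro V _ _ v
    conv_lhs => rw [← Complex.re_add_im z, add_smul, mul_smul]
    rfl
  rw [h v, map_add, map_smul, map_smul, hD, RingHom.id_apply]
  conv_rhs => rw [← Complex.re_add_im z, add_smul, mul_smul]
  rfl

theorem DifferentiableAt.complex_of_real {f : E → F} {x : E} (hf : DifferentiableAt ℝ f x)
    (h : ∀ v, fderiv ℝ f x (Complex.I • v) = Complex.I • fderiv ℝ f x v) :
    DifferentiableAt ℂ f x :=
  (differentiableAt_iff_restrictScalars ℝ hf).2
    ((fderiv ℝ f x).exists_restrictScalars_eq h)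

/-- A holomorphic map which is smooth in the real sense is smooth in the complex sense. The
derivative of a directional derivative is complex linear by symmetry of second derivatives. -/
theorem ContDiffOn.complex_of_real [FiniteDimensional ℂ E] {f : E → F} {s : Set E}
    (hs : IsOpen s) (hf : ContDiffOn ℝ ∞ f s) (hd : DifferentiableOn ℂ f s) :
    ContDiffOn ℂ ∞ f s := by
  rw [contDiffOn_infty]
  intro n
  induction n generalizing f with
  | zero => exact contDiffOn_zero.2 hf.continuousOn
  | succ n ih =>
    rw [Nat.cast_succ]
    refine contDiffOn_succ_of_fderiv_apply hd (by simp) fun y => ?_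
    have hre : ∀ x ∈ s, ∀ y, fderiv ℂ f x y = fderiv ℝ f x y := fun x hx y => by
      rw [((hd x hx).differentiableAt (hs.mem_nhds hx)).fderiv_restrictScalars ℝ]; rfl
    have hC : ∀ x ∈ s, ContDiffAt ℝ ∞ f x := fun x hx => hf.contDiffAt (hs.mem_nhds hx)
    have hsm : ContDiffOn ℝ ∞ (fun x => fderiv ℝ f x y) s := fun x hx =>
      (((hC x hx).fderiv_right (m := ∞) (by simp)).clm_apply contDiffAt_const).contDiffWithinAt
    have hdd : ∀ x ∈ s, DifferentiableAt ℝ (fderiv ℝ f) x := fun x hx =>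
      ((hC x hx).fderiv_right (m := ∞) (by simp)).differentiableAt (by simp)
    have hap : ∀ x ∈ s, ∀ y v, fderiv ℝ (fun x => fderiv ℝ f x y) x v =
        fderiv ℝ (fderiv ℝ f) x v y := fun x hx y v => by
      rw [((hdd x hx).hasFDerivAt.clm_apply (hasFDerivAt_const y x)).fderiv]
      simp
    have hsymm : ∀ x ∈ s, IsSymmSndFDerivAt ℝ f x := fun x hx =>
      (hC x hx).isSymmSndFDerivAt
        (by
          rw [minSmoothness_of_isRCLikeNormedField]
          exact WithTop.coe_le_coe.2 (le_top : (2 : ℕ∞) ≤ ⊤))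
    refine (ih hsm fun x hx => ?_).congr fun x hx => ?_
    · refine (DifferentiableAt.complex_of_real
        ((hsm.contDiffAt (hs.mem_nhds hx)).differentiableAt (by simp)) fun v => ?_
        ).differentiableWithinAt
      rw [hap x hx, hap x hx, hsymm x hx, hsymm x hx v, ← hap x hx, ← hap x hx]
      have hev : (fun x => fderiv ℝ f x (Complex.I • v)) =ᶠ[𝓝 x]
          fun x => Complex.I • fderiv ℝ f x v := by
        filter_upwards [hs.mem_nhds hx] with x' hx'
        rw [← hre x' hx', ← hre x' hx', map_smul]
      rw [hev.fderiv_eq]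
      have := ((hdd x hx).hasFDerivAt.clm_apply (hasFDerivAt_const v x))
      have hI : HasFDerivAt (fun x => Complex.I • fderiv ℝ f x v) _ x := this.const_smul Complex.I
      rw [hI.fderiv, this.fderiv]
      rfl
    · rw [fderivWithin_of_isOpen hs hx, hre x hx]

theorem eventually_contDiffAt_complex_of_real [FiniteDimensional ℂ E] {f : E → F} {x : E}
    (hf : ∀ᶠ y in 𝓝 x, ContDiffAt ℝ ∞ f y)
    (hd : ∀ᶠ y in 𝓝 x, ∀ v, fderiv ℝ f y (Complex.I • v) = Complex.I • fderiv ℝ f y v) :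
    ∀ᶠ y in 𝓝 x, ContDiffAt ℂ ∞ f y := by
  obtain ⟨s, hs, hso, hxs⟩ := eventually_nhds_iff.1 (hf.and hd)
  have := ContDiffOn.complex_of_real hso (fun y hy => (hs y hy).1.contDiffWithinAt)
    fun y hy => (DifferentiableAt.complex_of_real ((hs y hy).1.differentiableAt (by simp))
      (hs y hy).2).differentiableWithinAt
  filter_upwards [hso.mem_nhds hxs] with y hy using this.contDiffAt (hso.mem_nhds hy)

end RealToComplex

/-! ### Holomorphic fields of subspaces -/

section HolomorphicDistribution

variable {E : Type*} [NormedAddCommGroup E] [NormedSpace ℂ E] [FiniteDimensional ℂ E]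

/-- A holomorphic field of complex subspaces of `E × E`, each of which projects isomorphically
onto the first factor, is the field of graphs of a holomorphic family of linear maps. -/
theorem exists_contDiffAt_graph {k : ℕ} {W : Fin k → E × E → E × E} {K : E × E → Set (E × E)}
    {p₀ : E × E} (hW : ∀ i, ∀ᶠ z in 𝓝 p₀, ContDiffAt ℂ ∞ (W i) z)
    (hli : ∀ᶠ z in 𝓝 p₀, LinearIndependent ℂ fun i => W i z)
    (hK : ∀ᶠ z in 𝓝 p₀, ∀ w, w ∈ K z ↔ w ∈ Submodule.span ℂ (range fun i => W i z))
    (hinj : ∀ᶠ z in 𝓝 p₀, ∀ v, (0, v) ∈ K z → v = 0)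
    (hsurj : ∀ᶠ z in 𝓝 p₀, ∀ h, ∃ v, (h, v) ∈ K z) :
    ∃ L : E × E → E →L[ℂ] E, ∀ᶠ z in 𝓝 p₀, ContDiffAt ℂ ∞ L z ∧
      ∀ w, w ∈ K z ↔ w.2 = L z w.1 := by
  have : CompleteSpace E := FiniteDimensional.complete ℂ E
  -- the subspace at `z` is the set of all `(A z c, B z c)`, so `L z = B z ∘ (A z)⁻¹`
  let A : E × E → (Fin k → ℂ) →L[ℂ] E := fun z =>
    ∑ i, ContinuousLinearMap.smulRightL ℂ (Fin k → ℂ) E (ContinuousLinearMap.proj i) (W i z).1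
  let B : E × E → (Fin k → ℂ) →L[ℂ] E := fun z =>
    ∑ i, ContinuousLinearMap.smulRightL ℂ (Fin k → ℂ) E (ContinuousLinearMap.proj i) (W i z).2
  have hA : ∀ z c, A z c = (∑ i, c i • W i z).1 := fun z c => by
    simp [A, Prod.fst_sum]
  have hB : ∀ z c, B z c = (∑ i, c i • W i z).2 := fun z c => by
    simp [B, Prod.snd_sum]
  refine ⟨fun z => (B z).comp (A z).inverse, ?_⟩
  filter_upwards [eventually_all.2 hW, hli, hK, hinj, hsurj] with z hWz hliz hKz hinjz hsurjz
  have hspan : ∀ w, w ∈ K z ↔ ∃ c : Fin k → ℂ, (A z c, B z c) = w := fun w => by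
    rw [hKz, Submodule.mem_span_range_iff_exists_fun]
    simp only [hA, hB]
  have hAinj : Function.Injective (A z) := by
    refine (injective_iff_map_eq_zero _).2 fun c hc => ?_
    have h0 : B z c = 0 := hinjz _ ((hspan _).2 ⟨c, by rw [hc]⟩)
    have h1 : ∑ i, c i • W i z = 0 := Prod.ext (by rw [← hA, hc]; rfl) (by rw [← hB, h0]; rfl)
    funext i
    exact Fintype.linearIndependent_iff.1 hliz c h1 i
  have hAsurj : Function.Surjective (A z) := fun h => by
    obtain ⟨v, hv⟩ := hsurjz h
    obtain ⟨c, hc⟩ := (hspan _).1 hv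
    exact ⟨c, congrArg Prod.fst hc⟩
  let e : (Fin k → ℂ) ≃L[ℂ] E :=
    (LinearEquiv.ofBijective (A z).toLinearMap ⟨hAinj, hAsurj⟩).toContinuousLinearEquiv
  have he : (e : (Fin k → ℂ) →L[ℂ] E) = A z := ContinuousLinearMap.ext fun c => rfl
  have hAsm : ContDiffAt ℂ ∞ A z := ContDiffAt.sum fun i _ =>
    (ContinuousLinearMap.contDiff _).contDiffAt.comp z (hWz i).fst
  have hBsm : ContDiffAt ℂ ∞ B z := ContDiffAt.sum fun i _ =>
    (ContinuousLinearMap.contDiff _).contDiffAt.comp z (hWz i).snd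
  have hinv : (A z).inverse = (e.symm : E →L[ℂ] (Fin k → ℂ)) := by
    rw [← he]; exact ContinuousLinearMap.inverse_equiv e
  have heA : ∀ c, e c = A z c := fun c => rfl
  refine ⟨hBsm.clm_comp ?_, fun w => ?_⟩
  · have := contDiffAt_map_inverse (𝕜 := ℂ) (n := ∞) e
    rw [he] at this
    exact this.comp z hAsm
  · rw [hspan, hinv]
    constructor
    · rintro ⟨c, rfl⟩
      simp [← heA]
    · intro hw
      refine ⟨e.symm w.1, Prod.ext ?_ hw.symm⟩
      simp [← heA]

end HolomorphicDistribution

/-! ### Holomorphy of the local transport map -/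

section HolomorphicTransport

variable {E C : Type*} [NormedAddCommGroup E] [NormedSpace ℂ E]
  [NormedAddCommGroup C] [NormedSpace ℝ C]

/-- Let `v = θ (u, c)` be the leaves of a foliation with transverse component `ψ`, tangent to
the graphs of linear maps `L (u, v)`. Then `θ (·, c)` solves the total differential equation
`∂θ/∂u = L (u, θ)`. -/
theorem eventually_fderiv_fst_eq {ψ : E × E → C} {θ : E × C → E} {L : E × E → E →L[ℝ] E}
    {p₀ : E × E}
    (hψ : ∀ᶠ z in 𝓝 p₀, ContDiffAt ℝ ∞ ψ z)
    (hθ : ∀ᶠ a in 𝓝 (p₀.1, ψ p₀), ContDiffAt ℝ ∞ θ a)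
    (hθ₀ : θ (p₀.1, ψ p₀) = p₀.2)
    (hψθ : ∀ᶠ a in 𝓝 (p₀.1, ψ p₀), ψ (a.1, θ a) = a.2)
    (hL : ∀ᶠ z in 𝓝 p₀, ∀ w : E × E, fderiv ℝ ψ z w = 0 → w.2 = L z w.1) :
    ∀ᶠ a in 𝓝 (p₀.1, ψ p₀), ∀ h, fderiv ℝ θ a (h, 0) = L (a.1, θ a) h := by
  have hc : ContinuousAt (fun a : E × C => (a.1, θ a)) (p₀.1, ψ p₀) :=
    continuousAt_fst.prodMk hθ.self_of_nhds.continuousAt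
  have hc₀ : (p₀.1, θ (p₀.1, ψ p₀)) = p₀ := by rw [hθ₀]
  rw [ContinuousAt, hc₀] at hc
  filter_upwards [hθ, hψθ.eventually_nhds, hc.eventually hψ, hc.eventually hL] with a h1 h2 h3 h4 h
  have d1 : HasFDerivAt (fun a : E × C => (a.1, θ a))
      ((ContinuousLinearMap.fst ℝ E C).prod (fderiv ℝ θ a)) a :=
    hasFDerivAt_fst.prodMk (h1.differentiableAt (by simp)).hasFDerivAt
  have d2 := (h3.differentiableAt (by simp)).hasFDerivAt.comp a d1
  have d3 := (hasFDerivAt_snd (𝕜 := ℝ) (p := a)).congr_of_eventuallyEq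
    (f₁ := ψ ∘ fun a : E × C => (a.1, θ a)) h2
  have d4 := DFunLike.congr_fun (d2.unique d3) (h, 0)
  exact h4 (h, fderiv ℝ θ a (h, 0)) d4

/-- The tangent spaces of the leaves `v = θ (u, c)` project onto the first factor. -/
theorem eventually_exists_fderiv_eq_zero {ψ : E × E → C} {θ : E × C → E} {p₀ : E × E}
    (hψ : ∀ᶠ z in 𝓝 p₀, ContDiffAt ℝ ∞ ψ z)
    (hθ : ∀ᶠ a in 𝓝 (p₀.1, ψ p₀), ContDiffAt ℝ ∞ θ a)
    (hθψ : ∀ᶠ z in 𝓝 p₀, θ (z.1, ψ z) = z.2)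
    (hψθ : ∀ᶠ a in 𝓝 (p₀.1, ψ p₀), ψ (a.1, θ a) = a.2) :
    ∀ᶠ z in 𝓝 p₀, ∀ h, ∃ v, fderiv ℝ ψ z (h, v) = 0 := by
  have hc : ContinuousAt (fun z : E × E => (z.1, ψ z)) p₀ :=
    continuousAt_fst.prodMk hψ.self_of_nhds.continuousAt
  filter_upwards [hψ, hθψ, hc.eventually hθ, hc.eventually hψθ.eventually_nhds]
    with z h1 h2 h3 h4 h
  have d1 : HasFDerivAt (fun a : E × C => (a.1, θ a))
      ((ContinuousLinearMap.fst ℝ E C).prod (fderiv ℝ θ (z.1, ψ z))) (z.1, ψ z) :=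
    hasFDerivAt_fst.prodMk (h3.differentiableAt (by simp)).hasFDerivAt
  have d2 := HasFDerivAt.comp (g := ψ) (g' := fderiv ℝ ψ z) (z.1, ψ z)
    (by
      simp only [h2]
      exact (h1.differentiableAt (by simp)).hasFDerivAt) d1
  have d3 := (hasFDerivAt_snd (𝕜 := ℝ) (p := (z.1, ψ z))).congr_of_eventuallyEq
    (f₁ := ψ ∘ fun a : E × C => (a.1, θ a)) h4
  exact ⟨_, DFunLike.congr_fun (d2.unique d3) (h, 0)⟩

/-- The derivative in the parameter `c` of a solution of `∂θ/∂u = L (u, θ)` satisfies the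
linearized equation. -/
theorem hasDerivAt_fderiv_snd {θ : E × C → E} {L : E × E → E →L[ℂ] E} {a : E × C}
    (hθ : ContDiffAt ℝ ∞ θ a) (hL : DifferentiableAt ℂ L (a.1, θ a))
    (hθL : ∀ᶠ a' in 𝓝 a, ∀ h, fderiv ℝ θ a' (h, 0) = L (a'.1, θ a') h) (κ : C) (h : E)
    {γ : ℝ → E × C} {t : ℝ} (hγt : γ t = a) (hγ : HasDerivAt γ (h, 0) t) :
    HasDerivAt (fun t => fderiv ℝ θ (γ t) (0, κ))
      (fderiv ℂ L (a.1, θ a) (0, fderiv ℝ θ a (0, κ)) h) t := by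
  have hdd : HasFDerivAt (fderiv ℝ θ) (fderiv ℝ (fderiv ℝ θ) a) a :=
    ((hθ.fderiv_right (m := ∞) (by simp)).differentiableAt (by simp)).hasFDerivAt
  have h1 : HasDerivAt (fun t => fderiv ℝ θ (γ t) (0, κ))
      (fderiv ℝ (fderiv ℝ θ) a (h, 0) (0, κ)) t := by
    have := (HasFDerivAt.comp_hasDerivAt (f := γ) (l := fderiv ℝ θ) t
      (by rw [hγt]; exact hdd) hγ).clm_apply (hasDerivAt_const t ((0, κ) : E × C))
    simpa using this
  have hsymm : IsSymmSndFDerivAt ℝ θ a := hθ.isSymmSndFDerivAt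
        (by
          rw [minSmoothness_of_isRCLikeNormedField]
          exact WithTop.coe_le_coe.2 (le_top : (2 : ℕ∞) ≤ ⊤))
  rw [hsymm] at h1
  have e1 := (hdd.clm_apply (hasFDerivAt_const ((h, 0) : E × C) a))
  have d1 : HasFDerivAt (fun a : E × C => (a.1, θ a))
      ((ContinuousLinearMap.fst ℝ E C).prod (fderiv ℝ θ a)) a :=
    hasFDerivAt_fst.prodMk (hθ.differentiableAt (by simp)).hasFDerivAt
  have d2 := HasFDerivAt.comp (g := L) a (hL.hasFDerivAt.restrictScalars ℝ) d1
  have d3 := (((ContinuousLinearMap.apply ℂ E h).restrictScalars ℝ).hasFDerivAt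
    (x := L (a.1, θ a))).comp a d2
  have d4 := d3.congr_of_eventuallyEq (f₁ := fun a => fderiv ℝ θ a (h, 0))
    (hθL.mono fun a' ha' => ha' h)
  have := DFunLike.congr_fun (e1.unique d4) (0, κ)
  simp only [add_apply, ContinuousLinearMap.comp_apply,
    ContinuousLinearMap.flip_apply, zero_apply, map_zero, zero_add] at this
  convert h1 using 1
  simpa using this.symm

/-- Transport along a foliation tangent to a holomorphic field of complex subspaces is
holomorphic. In the last variable this is the hypothesis on the tangent spaces. In the second
one, the failure of the derivative to be complex linear solves a linear differential equation with
initial value zero. For the first one, `ψ` is constant in the directions `(h, L h)`. -/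
theorem eventually_contDiffAt_complex_transport [FiniteDimensional ℂ E] {ψ : E × E → C}
    {θ : E × C → E} {L : E × E → E →L[ℂ] E} {p₀ : E × E}
    (hψ : ∀ᶠ z in 𝓝 p₀, ContDiffAt ℝ ∞ ψ z)
    (hθ : ∀ᶠ a in 𝓝 (p₀.1, ψ p₀), ContDiffAt ℝ ∞ θ a)
    (hθψ : ∀ᶠ z in 𝓝 p₀, θ (z.1, ψ z) = z.2)
    (hψθ : ∀ᶠ a in 𝓝 (p₀.1, ψ p₀), ψ (a.1, θ a) = a.2)
    (hL : ∀ᶠ z in 𝓝 p₀, ContDiffAt ℂ ∞ L z ∧ ∀ w, fderiv ℝ ψ z w = 0 ↔ w.2 = L z w.1) :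
    ∀ᶠ p in 𝓝 (p₀, p₀.1), ContDiffAt ℂ ∞ (fun p : (E × E) × E => θ (p.2, ψ p.1)) p := by
  have hcont₁ : Tendsto (fun p : (E × E) × E => p.1) (𝓝 (p₀, p₀.1)) (𝓝 p₀) := by
    have : ContinuousAt (fun p : (E × E) × E => p.1) (p₀, p₀.1) := by fun_prop
    exact this
  have hcont₂ : Tendsto (fun p : (E × E) × E => (p.2, ψ p.1)) (𝓝 (p₀, p₀.1))
      (𝓝 (p₀.1, ψ p₀)) := by
    refine Tendsto.prodMk_nhds ?_ (hψ.self_of_nhds.continuousAt.tendsto.comp hcont₁)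
    have : ContinuousAt (fun p : (E × E) × E => p.2) (p₀, p₀.1) := by fun_prop
    exact this
  have hcont₃ : Tendsto (fun p : (E × E) × E => (p.1.1, ψ p.1)) (𝓝 (p₀, p₀.1))
      (𝓝 (p₀.1, ψ p₀)) := by
    refine Tendsto.prodMk_nhds ?_ (hψ.self_of_nhds.continuousAt.tendsto.comp hcont₁)
    have : ContinuousAt (fun p : (E × E) × E => p.1.1) (p₀, p₀.1) := by fun_prop
    exact this
  have hθc : Tendsto (fun a : E × C => (a.1, θ a)) (𝓝 (p₀.1, ψ p₀)) (𝓝 p₀) := by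
    have : ContinuousAt (fun a : E × C => (a.1, θ a)) (p₀.1, ψ p₀) :=
      continuousAt_fst.prodMk hθ.self_of_nhds.continuousAt
    rwa [ContinuousAt, hθψ.self_of_nhds] at this
  refine eventually_contDiffAt_complex_of_real ?_ ?_
  · filter_upwards [hcont₁.eventually hψ, hcont₂.eventually hθ] with p h1 h2
    exact h2.comp p (contDiffAt_snd.prodMk (h1.comp p contDiffAt_fst))
  have hode := eventually_fderiv_fst_eq (L := fun z => (L z).restrictScalars ℝ) hψ hθ
    hθψ.self_of_nhds hψθ (hL.mono fun z hz w hw => (hz.2 w).1 hw)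
  have hbound : ∀ᶠ z in 𝓝 p₀, ‖fderiv ℂ L z‖ < ‖fderiv ℂ L p₀‖ + 1 :=
    (hL.self_of_nhds.1.continuousAt_fderiv (by simp)).norm.eventually_lt_const (lt_add_one _)
  obtain ⟨r, hr, hball⟩ := Metric.eventually_nhds_iff_ball.1
    (hθ.and (hode.eventually_nhds.and ((hθc.eventually hL).and (hθc.eventually hbound))))
  filter_upwards [hcont₂.eventually (Metric.ball_mem_nhds _ hr),
    hcont₃.eventually (Metric.ball_mem_nhds _ hr), hcont₁.eventually hψ,
    hcont₁.eventually hθψ.eventually_nhds, hcont₁.eventually hL]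
    with p hp2 hp1 hψp hθψp hLp
  set c := ψ p.1 with hc
  have hDψ : HasFDerivAt ψ (fderiv ℝ ψ p.1) p.1 := (hψp.differentiableAt (by simp)).hasFDerivAt
  have hDθ : ∀ a ∈ Metric.ball (p₀.1, ψ p₀) r, HasFDerivAt θ (fderiv ℝ θ a) a := fun a ha =>
    ((hball a ha).1.differentiableAt (by simp)).hasFDerivAt
  -- the derivative of transport in the direction `k` of the second variable, as a function of the
  -- last variable `u`
  let Y : E → E → E := fun k u => fderiv ℝ θ (u, c) (0, fderiv ℝ ψ p.1 (0, k))
  have hY₁ : ∀ k, Y k p.1.1 = k := by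
    intro k
    have d1 : HasFDerivAt (fun z : E × E => (z.1, ψ z))
        ((ContinuousLinearMap.fst ℝ E E).prod (fderiv ℝ ψ p.1)) p.1 := hasFDerivAt_fst.prodMk hDψ
    have d2 := (hDθ _ hp1).comp (f := fun z : E × E => (z.1, ψ z)) p.1 d1
    have d3 := (hasFDerivAt_snd (𝕜 := ℝ) (p := p.1)).congr_of_eventuallyEq
      (f₁ := θ ∘ fun z : E × E => (z.1, ψ z)) hθψp
    exact DFunLike.congr_fun (d2.unique d3) (0, k)
  have hY₂ : ∀ k, Y (Complex.I • k) p.2 = Complex.I • Y k p.2 := by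
    intro k
    set h := p.2 - p.1.1 with hh
    -- along the segment from `p.1.1` to `p.2`, the antilinear defect `δ` satisfies a linear
    -- differential equation, and it vanishes at the start
    let γ : ℝ → E × C := fun t => (p.1.1 + t • h, c)
    have hγmem : ∀ t ∈ Icc (0 : ℝ) 1, γ t ∈ Metric.ball (p₀.1, ψ p₀) r := by
      intro t ht
      have := (convex_ball (p₀.1, ψ p₀) r).add_smul_sub_mem hp1 hp2 ht
      convert this using 1
      ext <;> simp [γ, hh]
    have hγ : ∀ t, HasDerivAt γ (h, 0) t := fun t => by
      have h1 : HasDerivAt (fun t : ℝ => p.1.1 + t • h) h t := by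
        simpa using ((hasDerivAt_id t).smul_const h).const_add p.1.1
      exact h1.prodMk (hasDerivAt_const _ _)
    let δ : ℝ → E := fun t => Y (Complex.I • k) (γ t).1 - Complex.I • Y k (γ t).1
    have hδ : ∀ t ∈ Icc (0 : ℝ) 1, HasDerivAt δ
        (fderiv ℂ L ((γ t).1, θ (γ t)) (0, δ t) h) t := by
      intro t ht
      obtain ⟨b1, b2, b3, b4⟩ := hball _ (hγmem t ht)
      have hD := fun κ => hasDerivAt_fderiv_snd b1 (b3.1.differentiableAt (by simp)) b2 κ h rfl
        (hγ t)
      have := (hD (fderiv ℝ ψ p.1 (0, Complex.I • k))).sub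
        ((hD (fderiv ℝ ψ p.1 (0, k))).const_smul Complex.I)
      refine HasDerivAt.congr_deriv (f := δ) this ?_
      rw [← smul_apply, ← map_smul, ← sub_apply, ← map_sub]
      congr 2
      ext
      · simp
      · simp [δ, Y, γ]
    have hδ₁ := eq_zero_of_abs_deriv_le_mul_abs_self_of_eq_zero_right
      (f := δ) (K := (‖fderiv ℂ L p₀‖ + 1) * ‖h‖) (a := 0) (b := 1)
      (fun t ht => (hδ t ht).continuousAt.continuousWithinAt)
      (fun t ht => (hδ t ⟨ht.1, ht.2.le⟩).hasDerivWithinAt)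
      (by simp [δ, γ, hY₁])
      (fun t ht => by
        obtain ⟨b1, b2, b3, b4⟩ := hball _ (hγmem t ⟨ht.1, ht.2.le⟩)
        calc ‖fderiv ℂ L ((γ t).1, θ (γ t)) (0, δ t) h‖
            ≤ ‖fderiv ℂ L ((γ t).1, θ (γ t)) (0, δ t)‖ * ‖h‖ := ContinuousLinearMap.le_opNorm _ _
          _ ≤ ‖fderiv ℂ L ((γ t).1, θ (γ t))‖ * ‖((0 : E), δ t)‖ * ‖h‖ := by
            gcongr; exact ContinuousLinearMap.le_opNorm _ _
          _ = ‖fderiv ℂ L ((γ t).1, θ (γ t))‖ * ‖δ t‖ * ‖h‖ := by simp [Prod.norm_def]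
          _ ≤ (‖fderiv ℂ L p₀‖ + 1) * ‖δ t‖ * ‖h‖ := by gcongr
          _ = (‖fderiv ℂ L p₀‖ + 1) * ‖h‖ * ‖δ t‖ := by ring)
      1 ⟨zero_le_one, le_rfl⟩
    have hγ₁ : (γ 1).1 = p.2 := by simp [γ, hh]
    simp only [δ, hγ₁] at hδ₁
    exact sub_eq_zero.1 hδ₁
  have hder : ∀ v : (E × E) × E, fderiv ℝ (fun p : (E × E) × E => θ (p.2, ψ p.1)) p v =
      L (p.2, θ (p.2, c)) v.2 + Y (v.1.2 - L p.1 v.1.1) p.2 := by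
    intro v
    have d1 : HasFDerivAt (fun p : (E × E) × E => (p.2, ψ p.1))
        ((ContinuousLinearMap.snd ℝ (E × E) E).prod
          ((fderiv ℝ ψ p.1).comp (ContinuousLinearMap.fst ℝ (E × E) E))) p :=
      hasFDerivAt_snd.prodMk (hDψ.comp p hasFDerivAt_fst)
    have d2 := (hDθ _ hp2).comp (f := fun p : (E × E) × E => (p.2, ψ p.1)) p d1
    have d3 : fderiv ℝ (fun p : (E × E) × E => θ (p.2, ψ p.1)) p v =
        fderiv ℝ θ (p.2, c) (v.2, fderiv ℝ ψ p.1 v.1) := DFunLike.congr_fun d2.fderiv v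
    -- `(h, L h)` is tangent to the leaf, so `ψ` does not vary in that direction
    have d4 : fderiv ℝ ψ p.1 v.1 = fderiv ℝ ψ p.1 (0, v.1.2 - L p.1 v.1.1) := by
      rw [← sub_eq_zero, ← map_sub, hLp.2]
      simp
    have d5 := (hball _ hp2).2.1.self_of_nhds v.2
    rw [d3, d4, ← show fderiv ℝ θ (p.2, c) (v.2, 0) = L (p.2, θ (p.2, c)) v.2 from d5, ← map_add]
    simp
  intro v
  rw [hder, hder, smul_add, ← hY₂]
  simp [smul_sub]

end HolomorphicTransport

/-! ### The holomorphic case on manifolds -/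

section ComplexManifold

variable {E M : Type*} [NormedAddCommGroup E] [NormedSpace ℂ E] [TopologicalSpace M]
  [ChartedSpace E M]

theorem isManifold_real_of_complex [IsManifold 𝓘(ℂ, E) ∞ M] : IsManifold 𝓘(ℝ, E) ∞ M := by
  refine isManifold_of_contDiffOn _ _ _ fun e e' he he' => ?_
  have h := HasGroupoid.compatible (G := contDiffGroupoid ∞ 𝓘(ℂ, E)) he he'
  exact ContDiffOn.restrict_scalars ℝ h.1

variable [IsManifold 𝓘(ℂ, E) ∞ M]

/-- The real and the complex derivative of the inverse of a product chart agree; the tangent spaces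
are all identified with `E × E`. -/
theorem mfderiv_prod_chart_symm_real_eq (x₀ y₀ : M) {z : E × E}
    (hz : z ∈ ((chartAt E x₀).prod (chartAt E y₀)).target) (w : E × E) :
    (mfderiv 𝓘(ℝ, E × E) (𝓘(ℝ, E).prod 𝓘(ℝ, E))
      ((chartAt E x₀).prod (chartAt E y₀)).symm z w : E × E) =
    (mfderiv 𝓘(ℂ, E × E) (𝓘(ℂ, E).prod 𝓘(ℂ, E))
      ((chartAt E x₀).prod (chartAt E y₀)).symm z w : E × E) := by
  have h : MDifferentiableAt 𝓘(ℂ, E × E) (𝓘(ℂ, E).prod 𝓘(ℂ, E))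
      ((chartAt E x₀).prod (chartAt E y₀)).symm z :=
    ((contMDiffOn_prod_chart_symm (𝕜 := ℂ) x₀ y₀).contMDiffAt
      (((chartAt E x₀).prod (chartAt E y₀)).open_target.mem_nhds hz)).mdifferentiableAt (by simp)
  let D : (E × E) →L[ℂ] (E × E) := mfderiv 𝓘(ℂ, E × E) (𝓘(ℂ, E).prod 𝓘(ℂ, E))
      ((chartAt E x₀).prod (chartAt E y₀)).symm z
  have h2 : HasMFDerivAt 𝓘(ℝ, E × E) (𝓘(ℝ, E).prod 𝓘(ℝ, E))
      ((chartAt E x₀).prod (chartAt E y₀)).symm z (D.restrictScalars ℝ) :=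
    ⟨h.hasMFDerivAt.1, HasFDerivWithinAt.restrictScalars ℝ (f' := D) h.hasMFDerivAt.2⟩
  exact DFunLike.congr_fun h2.mfderiv w

/-- The tangent field of a holomorphic foliation has, in the product of two charts of `M`, a
holomorphic frame. -/
theorem Foliation.IsHolomorphic.exists_frame {F : Foliation (𝓘(ℝ, E).prod 𝓘(ℝ, E)) (M × M)}
    (hF : F.IsHolomorphic) (x₀ y₀ : M) :
    ∃ (k : ℕ) (W : Fin k → E × E → E × E),
      (∀ i, ∀ᶠ z in 𝓝 (chartAt E x₀ x₀, chartAt E y₀ y₀), ContDiffAt ℂ ∞ (W i) z) ∧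
      (∀ᶠ z in 𝓝 (chartAt E x₀ x₀, chartAt E y₀ y₀), LinearIndependent ℂ fun i => W i z) ∧
      ∀ᶠ z in 𝓝 (chartAt E x₀ x₀, chartAt E y₀ y₀), ∀ w : E × E,
        mfderiv 𝓘(ℝ, E × E) (𝓘(ℝ, E).prod 𝓘(ℝ, E))
          ((chartAt E x₀).prod (chartAt E y₀)).symm z w ∈
            F.tangent (((chartAt E x₀).prod (chartAt E y₀)).symm z) ↔
          w ∈ Submodule.span ℂ (range fun i => W i z) := by
  obtain ⟨k, V, U, hU, hpU, hV, hspan⟩ := hF (x₀, y₀)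
  have : IsManifold 𝓘(ℂ, E) 1 M := IsManifold.of_le (n := ∞) (by simp)
  set κ := (chartAt E x₀).prod (chartAt E y₀) with hκ
  set p₀ : E × E := (chartAt E x₀ x₀, chartAt E y₀ y₀) with hp₀
  have hp₀t : p₀ ∈ κ.target := ⟨mem_chart_target E x₀, mem_chart_target E y₀⟩
  have hκp₀ : κ.symm p₀ = (x₀, y₀) :=
    κ.left_inv (x := (x₀, y₀)) ⟨mem_chart_source E x₀, mem_chart_source E y₀⟩
  have hκs := contMDiffOn_prod_chart_symm (𝕜 := ℂ) (E := E) x₀ y₀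
  have hκd : κ.MDifferentiable (𝓘(ℂ, E).prod 𝓘(ℂ, E)) 𝓘(ℂ, E × E) :=
    ⟨(contMDiffOn_prod_chart x₀ y₀).mdifferentiableOn (by simp),
      hκs.mdifferentiableOn (by simp)⟩
  have hgood : ∀ᶠ z in 𝓝 p₀, z ∈ κ.target ∧ κ.symm z ∈ U := by
    refine (κ.isOpen_inter_preimage_symm hU).mem_nhds ⟨hp₀t, ?_⟩
    rw [mem_preimage, hκp₀]; exact hpU
  let D' : M × M → (E × E) →L[ℂ] (E × E) := fun x =>
    mfderiv (𝓘(ℂ, E).prod 𝓘(ℂ, E)) 𝓘(ℂ, E × E) κ x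
  let D : E × E → (E × E) →L[ℂ] (E × E) := fun z =>
    mfderiv 𝓘(ℂ, E × E) (𝓘(ℂ, E).prod 𝓘(ℂ, E)) κ.symm z
  have hDD' : ∀ z ∈ κ.target, ∀ v, D z (D' (κ.symm z) v) = v := fun z hz v => by
    have := hκd.symm_comp_deriv (κ.map_target hz)
    rw [κ.right_inv hz] at this
    exact DFunLike.congr_fun this v
  have hD'D : ∀ z ∈ κ.target, ∀ w, D' (κ.symm z) (D z w) = w := fun z hz w =>
    DFunLike.congr_fun (hκd.comp_symm_deriv hz) w
  let W : Fin k → E × E → E × E := fun i z => D' (κ.symm z) (V i (κ.symm z))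
  refine ⟨k, W, fun i => ?_, ?_, ?_⟩
  · filter_upwards [hgood] with z hz
    let e := trivializationAt (E × E) (TangentSpace (𝓘(ℂ, E).prod 𝓘(ℂ, E)) (M := M × M)) (x₀, y₀)
    have hbase : ∀ x ∈ κ.source, x ∈ e.baseSet := fun x hx => hx
    have h1 : ContMDiffAt (𝓘(ℂ, E).prod 𝓘(ℂ, E)) 𝓘(ℂ, E × E) ∞
        (fun x => (e ⟨x, V i x⟩).2) (κ.symm z) :=
      (e.contMDiffAt_section_iff (hbase _ (κ.map_target hz.1))).1
        ((hV i).contMDiffAt (hU.mem_nhds hz.2))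
    have h2 : ∀ x ∈ κ.source, (e ⟨x, V i x⟩).2 = D' x (V i x) := fun x hx => by
      have h3 := TangentBundle.continuousLinearMapAt_trivializationAt
        (I := 𝓘(ℂ, E).prod 𝓘(ℂ, E)) (x₀ := (x₀, y₀)) (x := x) hx
      have h4 := DFunLike.congr_fun h3 (V i x)
      rw [Bundle.Trivialization.continuousLinearMapAt_apply_of_mem _ _ (hbase x hx)] at h4
      exact h4
    rw [← contMDiffAt_iff_contDiffAt]
    refine ContMDiffAt.congr_of_eventuallyEq (h1.comp z
      (hκs.contMDiffAt (κ.open_target.mem_nhds hz.1))) ?_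
    filter_upwards [κ.open_target.mem_nhds hz.1] with z' hz'
    exact (h2 _ (κ.map_target hz')).symm
  · filter_upwards [hgood] with z hz
    refine (hspan _ hz.2).1.map' (D' (κ.symm z)).toLinearMap (LinearMap.ker_eq_bot.2 ?_)
    exact fun v v' hvv' => by
      rw [← hDD' z hz.1 v, ← hDD' z hz.1 v']
      exact congrArg (D z) hvv'
  · filter_upwards [hgood] with z hz w
    let V₀ : Fin k → E × E := fun i => V i (κ.symm z)
    have h1 : Submodule.span ℂ (range fun i => W i z) =
        (Submodule.span ℂ (range V₀)).map (D' (κ.symm z)).toLinearMap := by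
      rw [Submodule.map_span, ← range_comp]; rfl
    have h2 : w ∈ Submodule.span ℂ (range fun i => W i z) ↔
        D z w ∈ Submodule.span ℂ (range V₀) := by
      rw [h1, Submodule.mem_map]
      constructor
      · rintro ⟨v, hv, rfl⟩
        exact (hDD' z hz.1 v).symm ▸ hv
      · exact fun h => ⟨D z w, h, hD'D z hz.1 w⟩
    rw [h2, mfderiv_prod_chart_symm_real_eq x₀ y₀ hz.1]
    exact (hspan _ hz.2).2 _

/-- Transport along the leaves of a holomorphic foliation is holomorphic, although the group
elements are only assumed to act smoothly in the real sense. -/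
theorem contMDiff_complex_transport {G : Type*} [Group G] [FiniteDimensional ℂ E]
    [SecondCountableTopology M] [ConnectedSpace M] [MulAction G M] [MulAction.IsPretransitive G M]
    {F : Foliation (𝓘(ℝ, E).prod 𝓘(ℝ, E)) (M × M)} (hhol : F.IsHolomorphic)
    (hF : Set.range (fun g : G => {p : M × M | p.2 = g • p.1}) = F.leaves)
    (hsm : ∀ g : G, ContMDiff 𝓘(ℝ, E) 𝓘(ℝ, E) ∞ (fun x : M => g • x))
    (hfree : ∀ (g : G) (x : M), g • x = x → g = 1) :
    ContMDiff ((𝓘(ℂ, E).prod 𝓘(ℂ, E)).prod 𝓘(ℂ, E)) 𝓘(ℂ, E) ∞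
      (fun p : (M × M) × M => transport G p.1.1 p.1.2 p.2) := by
  have : IsManifold 𝓘(ℝ, E) ∞ M := isManifold_real_of_complex
  refine contMDiff_transport_of_eventually hfree (fun g => (hsm g).continuous) fun x₀ y₀ => ?_
  obtain ⟨ψ, θ, hψ, hθ, hθψ, hψθ, htan, hvert, htr⟩ := exists_local_transport hF hsm hfree x₀ y₀
  obtain ⟨k, W, hW, hli, hspan⟩ := hhol.exists_frame x₀ y₀
  obtain ⟨L, hL⟩ := exists_contDiffAt_graph (K := fun z => {w | fderiv ℝ ψ z w = 0}) hW hli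
    (by
      filter_upwards [htan, hspan] with z h1 h2 w
      exact (h1 w).trans (h2 w))
    hvert (eventually_exists_fderiv_eq_zero hψ hθ hθψ hψθ)
  exact eventually_contMDiffAt_transport_of_coord x₀ y₀ (fun p => θ (p.2, ψ p.1))
    (eventually_contDiffAt_complex_transport hψ hθ hθψ hψθ hL) hθψ.self_of_nhds htr

end ComplexManifold

theorem theorem2p6 {G M : Type*} [Group G] [TopologicalSpace M] [T2Space M]
    [SecondCountableTopology M] [ConnectedSpace M] [MulAction G M] [FaithfulSMul G M] :
    -- the smooth case, `dim M = m`
    (∀ (m : ℕ) [ChartedSpace (EuclideanSpace ℝ (Fin m)) M]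
        [IsManifold 𝓘(ℝ, EuclideanSpace ℝ (Fin m)) ∞ M],
      (∀ g : G, ContMDiff 𝓘(ℝ, EuclideanSpace ℝ (Fin m)) 𝓘(ℝ, EuclideanSpace ℝ (Fin m)) ∞
        (fun x : M => g • x)) →
      ∀ F : Foliation (𝓘(ℝ, EuclideanSpace ℝ (Fin m)).prod 𝓘(ℝ, EuclideanSpace ℝ (Fin m)))
          (M × M),
        Set.range (fun g : G => {p : M × M | p.2 = g • p.1}) = F.leaves →
        (∀ (g : G) (x : M), g • x = x → g = 1) ∧
        MulAction.IsPretransitive G M ∧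
        ∃ S : LieGroupStructure ℝ (EuclideanSpace ℝ (Fin m)) G, S.ActsSmoothlyOn M ∧
          ∀ T : LieGroupStructure ℝ (EuclideanSpace ℝ (Fin m)) G, T.ActsSmoothlyOn M →
            T.Same S) ∧
    -- the holomorphic case, `dim_ℂ M = n`; the action is by diffeomorphisms of the underlying
    -- smooth manifold
    (∀ (n : ℕ) [ChartedSpace (EuclideanSpace ℂ (Fin n)) M]
        [IsManifold 𝓘(ℂ, EuclideanSpace ℂ (Fin n)) ∞ M],
      (∀ g : G, ContMDiff 𝓘(ℝ, EuclideanSpace ℂ (Fin n)) 𝓘(ℝ, EuclideanSpace ℂ (Fin n)) ∞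
        (fun x : M => g • x)) →
      ∀ F : Foliation (𝓘(ℝ, EuclideanSpace ℂ (Fin n)).prod 𝓘(ℝ, EuclideanSpace ℂ (Fin n)))
          (M × M),
        F.IsHolomorphic →
        Set.range (fun g : G => {p : M × M | p.2 = g • p.1}) = F.leaves →
        (∀ (g : G) (x : M), g • x = x → g = 1) ∧
        MulAction.IsPretransitive G M ∧
        ∃ S : LieGroupStructure ℂ (EuclideanSpace ℂ (Fin n)) G, S.ActsSmoothlyOn M ∧
          ∀ T : LieGroupStructure ℂ (EuclideanSpace ℂ (Fin n)) G, T.ActsSmoothlyOn M →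
            T.Same S) := by
  obtain ⟨x₀⟩ : Nonempty M := inferInstance
  constructor
  · intro m _ _ hsm F hF
    have htrans := isPretransitive_of_graphs_eq_leaves hF
    have hfree := eq_one_of_graphs_eq_leaves hF
    obtain ⟨S, hS⟩ := exists_lieGroupStructure hfree x₀ (contMDiff_transport hF hsm hfree)
    exact ⟨hfree, htrans, S, hS, fun T hT =>
      ⟨T.idContMDiff_of_actsSmoothlyOn hfree x₀ S hT hS,
        S.idContMDiff_of_actsSmoothlyOn hfree x₀ T hS hT⟩⟩
  · intro n _ _ hsm F hhol hF
    have htrans := isPretransitive_of_graphs_eq_leaves hF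
    have hfree := eq_one_of_graphs_eq_leaves hF
    obtain ⟨S, hS⟩ := exists_lieGroupStructure hfree x₀
      (contMDiff_complex_transport hhol hF hsm hfree)
    exact ⟨hfree, htrans, S, hS, fun T hT =>
      ⟨T.idContMDiff_of_actsSmoothlyOn hfree x₀ S hT hS,
        S.idContMDiff_of_actsSmoothlyOn hfree x₀ T hS hT⟩⟩
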